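/- Let $K$ be an algebraically closed field of characteristic $0$, let $n\ge 2$, and let $C$ be the dual coalgebra of $K[y]/(y^n)$, with basis $x_0,\dots,x_{n-1}$ dual to $1,y,\dots,y^{n-1}$; so $\Delta(x_i)=\sum_{j+k=i}x_j\otimes x_k$ and $\epsilon(x_i)=\delta_{i0}$. **Definitions.** Let $\mathfrak p,\mathfrak d\colon C\otimes C\to C$ be coalgebra morphisms, and write $a\cdot b=\mathfrak p(a\otimes b)$, $a:b=\mathfrak d(a\otimes b)$, $\mathfrak p(x_i\otimes x_j)=\sum_k\mathfrak p_{ij}^k x_k$. The triple $(C,\mathfrak p,\mathfrak d)$ is a *regular $q$-cycle coalgebra* if there are coalgebra morphisms $a\otimes b\mapsto a^b$ and $a\otimes b\mapsto a_b$ from $C\otimes C$ to $C$ with $$a^{b_{(1)}}\cdot b_{(2)}=(a\cdot b_{(1)})^{b_{(2)}}=\epsilon(b)a,\qquad (a:b_{(2)})_{b_{(1)}}=a_{b_{(2)}}:b_{(1)}=\epsilon(b)a,$$ and for all $a,b,c\in C$ 1. $(a\cdot b_{(1)})\cdot(c:b_{(2)})=(a\cdot c_{(2)})\cdot(b\cdot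 c_{(1)})$, 2. $(a\cdot b_{(1)}):(c\cdot b_{(2)})=(a:c_{(2)})\cdot(b:c_{(1)})$, 3. $(a:b_{(1)}):(c:b_{(2)})=(a:c_{(2)}):(b\cdot c_{(1)})$. Its associated solution of the braid equation is $s(a\otimes b)={}^{a_{(1)}}b_{(2)}\otimes a_{(2)}{}^{b_{(1)}}$, where ${}^ab=b_{(2)}:a^{b_{(1)}}$ (the map $a\otimes b\mapsto a^b$ is unique). A pair $(C,\mathfrak q)$ is a *cycle coalgebra* if $(C,\mathfrak q,\mathfrak q)$ is a regular $q$-cycle coalgebra. Let $v_0\ge 1$ and let $f=1+\sum_{v_0\le v<n}p_vx^v\in K[x]$ with $p_{v_0}=1$. Let $g\in K[[x]]$ be given by $gf'=f(f^{v_0}-1)$, and let $G\in K[[x]][[y]]$ be the unique series with $G(x,0)=x$ and $G_y=g(x)f'(y)G_x-(f(y)-1)G_y$. Put $q_{uv}^0=\delta_{0,u+v}$, $G=\sum_{u,v}q_{uv}^1x^uy^v$, and $q_{uv}^w=\sum_{u_1+u_2=u,\,v_1+v_2=v}q_{u_1v_1}^1q_{u_2v_2}^{w-1}$ for $w>1$.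 The pair $(C,\mathfrak q)$ with $\mathfrak q(x_i\otimes x_j)=\sum_{k<n}q_{ij}^kx_k$ is the *standard cycle coalgebra of degree $v_0$ associated with $f$*, denoted $\mathrm{SCC}(f)$. For $\lambda\in K^\times$ let $f_\lambda\colon C\to C$ be the coalgebra automorphism $f_\lambda(x_i)=\lambda^ix_i$. It is an isomorphism from $(C,\mathfrak p,\mathfrak d)$ to $(C,\mathfrak p',\mathfrak d')$ if $f_\lambda\circ\mathfrak p=\mathfrak p'\circ(f_\lambda\otimes f_\lambda)$ and $f_\lambda\circ\mathfrak d=\mathfrak d'\circ(f_\lambda\otimes f_\lambda)$. **Corollary 4.6.** Let $(C,\mathfrak p,\mathfrak d)$ be a regular $q$-cycle coalgebra with $\mathfrak p_{11}^1\ne 0$. Then there is a polynomial $f=1+x+\sum_{v=2}^{n-1}p_vx^v$ such that $\mathrm{SCC}(f)=(C,\mathfrak q)$ is a cycle coalgebra and, for $\lambda=\mathfrak p_{11}^1$, the map $f_\lambda$ is an isomorphism from $(C,\mathfrak p,\mathfrak d)$ to $(C,\mathfrak q,\mathfrak q)$. It is unique: if $\mu\in K^\times$ and $f_\mu$ is an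 isomorphism from $(C,\mathfrak p,\mathfrak d)$ to $(C,\mathfrak q',\mathfrak q')$, where $(C,\mathfrak q')=\mathrm{SCC}(f')$ is of degree $1$, then $\mu=\mathfrak p_{11}^1$, $f'=f$ and $\mathfrak q'=\mathfrak q$. Moreover $\mathfrak d=\mathfrak p$, and the associated solution of the braid equation is involutive: $s\circ s=\mathrm{id}$. -/

import Mathlib

open scoped TensorProduct

/-! ### Regular `q`-cycle coalgebras over a cocommutative coalgebra -/

section General

variable {K C : Type*} [Field K] [AddCommGroup C] [Module K C] [Coalgebra K C]

/-- `m(a ⊗ -) : C → C`, for a fixed left argument `a`. -/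
noncomputable def leftArg (m : C ⊗[K] C →ₗ[K] C) (a : C) : C →ₗ[K] C :=
  m ∘ₗ TensorProduct.mk K C C a

/-- `m(φ(b₍₁₎) ⊗ ψ(b₍₂₎))`. -/
noncomputable def sweedler (m : C ⊗[K] C →ₗ[K] C) (φ ψ : C →ₗ[K] C) (b : C) : C :=
  m (TensorProduct.map φ ψ (Coalgebra.comul (R := K) b))

/-- `m(φ(b₍₂₎) ⊗ ψ(b₍₁₎))`. -/
noncomputable def sweedlerOp (m : C ⊗[K] C →ₗ[K] C) (φ ψ : C →ₗ[K] C) (b : C) : C :=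
  m (TensorProduct.map φ ψ (TensorProduct.comm K C C (Coalgebra.comul (R := K) b)))

/-- `a ⊗ b ↦ aᵇ := r(a ⊗ b)` inverts `p` on the right argument:
`a^{b₍₁₎} · b₍₂₎ = (a · b₍₁₎)^{b₍₂₎} = ε(b) a`, where `a · b = p(a ⊗ b)`. -/
def IsInverseAction (p r : C ⊗[K] C →ₗ[K] C) : Prop :=
  ∀ a b : C,
    sweedler p (leftArg r a) LinearMap.id b = Coalgebra.counit (R := K) b • a ∧
    sweedler r (leftArg p a) LinearMap.id b = Coalgebra.counit (R := K) b • a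

/-- `a ⊗ b ↦ a_b := r(a ⊗ b)` inverts `d` on the right argument, with the opposite comultiplication:
`(a : b₍₂₎)_{b₍₁₎} = a_{b₍₂₎} : b₍₁₎ = ε(b) a`, where `a : b = d(a ⊗ b)`. -/
def IsInverseActionOp (d r : C ⊗[K] C →ₗ[K] C) : Prop :=
  ∀ a b : C,
    sweedlerOp r (leftArg d a) LinearMap.id b = Coalgebra.counit (R := K) b • a ∧
    sweedlerOp d (leftArg r a) LinearMap.id b = Coalgebra.counit (R := K) b • a

/-- `(C, p, d)` is a regular `q`-magma coalgebra. -/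
def IsRegularQMagmaCoalgebra (p d : C ⊗[K] C →ₗc[K] C) : Prop :=
  (∃ r : C ⊗[K] C →ₗc[K] C, IsInverseAction p.toLinearMap r.toLinearMap) ∧
  (∃ r : C ⊗[K] C →ₗc[K] C, IsInverseActionOp d.toLinearMap r.toLinearMap)

/-- `(C, p, d)` is a regular `q`-cycle coalgebra; with `a · b = p(a ⊗ b)` and `a : b = d(a ⊗ b)`:
1. `(a · b₍₁₎) · (c : b₍₂₎) = (a · c₍₂₎) · (b · c₍₁₎)`;
2. `(a · b₍₁₎) : (c · b₍₂₎) = (a : c₍₂₎) · (b : c₍₁₎)`;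
3. `(a : b₍₁₎) : (c : b₍₂₎) = (a : c₍₂₎) : (b · c₍₁₎)`. -/
structure IsRegularQCycleCoalgebra (p d : C ⊗[K] C →ₗc[K] C) : Prop where
  regular : IsRegularQMagmaCoalgebra p d
  cycle₁ : ∀ a b c : C,
    sweedler p.toLinearMap (leftArg p.toLinearMap a) (leftArg d.toLinearMap c) b =
      sweedlerOp p.toLinearMap (leftArg p.toLinearMap a) (leftArg p.toLinearMap b) c
  cycle₂ : ∀ a b c : C,
    sweedler d.toLinearMap (leftArg p.toLinearMap a) (leftArg p.toLinearMap c) b =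
      sweedlerOp p.toLinearMap (leftArg d.toLinearMap a) (leftArg d.toLinearMap b) c
  cycle₃ : ∀ a b c : C,
    sweedler d.toLinearMap (leftArg d.toLinearMap a) (leftArg d.toLinearMap c) b =
      sweedlerOp d.toLinearMap (leftArg d.toLinearMap a) (leftArg p.toLinearMap b) c

/-- `(C, p)` is a (regular) cycle coalgebra. -/
def IsCycleCoalgebra (p : C ⊗[K] C →ₗc[K] C) : Prop := IsRegularQCycleCoalgebra p p

/-- The coalgebra automorphism `e` is an isomorphism `(C, p, d) ≅ (C, p', d')`. -/
def IsQMagmaIso (e : C ≃ₗc[K] C) (p d p' d' : C ⊗[K] C →ₗc[K] C) : Prop :=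
  ∀ a b : C, e (p (a ⊗ₜ[K] b)) = p' (e a ⊗ₜ[K] e b) ∧ e (d (a ⊗ₜ[K] b)) = d' (e a ⊗ₜ[K] e b)

/-- `a ⊗ b ↦ ᵃb := b₍₂₎ : a^{b₍₁₎}`, where `aᵇ = r(a ⊗ b)` and `a : b = d(a ⊗ b)`. -/
noncomputable def leftAction (d r : C ⊗[K] C →ₗ[K] C) : C ⊗[K] C →ₗ[K] C :=
  d ∘ₗ (TensorProduct.comm K C C).toLinearMap ∘ₗ r.rTensor C ∘ₗ
    (TensorProduct.assoc K C C C).symm.toLinearMap ∘ₗ (Coalgebra.comul (R := K) (A := C)).lTensor C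

/-- `a ⊗ b ↦ ^{a₍₁₎}b₍₂₎ ⊗ a₍₂₎^{b₍₁₎}`. -/
noncomputable def braiding (d r : C ⊗[K] C →ₗ[K] C) : C ⊗[K] C →ₗ[K] C ⊗[K] C :=
  TensorProduct.map (leftAction d r) r ∘ₗ
    (TensorProduct.tensorTensorTensorComm K C C C C).toLinearMap ∘ₗ
    TensorProduct.map (Coalgebra.comul (R := K) (A := C))
      ((TensorProduct.comm K C C).toLinearMap ∘ₗ Coalgebra.comul (R := K) (A := C))

/-- The solution `s` of the braid equation associated with `(C, p, d)` is involutive: `s ∘ s = id`.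
(In the regular case the map `a ⊗ b ↦ aᵇ` inverse to `p` exists and is unique.) -/
def HasInvolutiveSolution (p d : C ⊗[K] C →ₗc[K] C) : Prop :=
  ∀ r : C ⊗[K] C →ₗc[K] C, IsInverseAction p.toLinearMap r.toLinearMap →
    braiding d.toLinearMap r.toLinearMap ∘ₗ braiding d.toLinearMap r.toLinearMap = LinearMap.id

end General

/-! ### The dual coalgebra of `K[y]/(yⁿ)` -/

/-- The dual of `K[y]/(yⁿ)`, in coordinates with respect to the basis `x₀, …, xₙ₋₁` dual to
`1, y, …, yⁿ⁻¹`. -/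
def TruncDual (K : Type*) (n : ℕ) : Type _ := Fin n → K

namespace TruncDual

variable {K : Type*} [Field K] {n : ℕ}

instance : AddCommGroup (TruncDual K n) := inferInstanceAs (AddCommGroup (Fin n → K))

instance : Module K (TruncDual K n) := inferInstanceAs (Module K (Fin n → K))

/-- The dual basis. -/
noncomputable def basis (K : Type*) [Field K] (n : ℕ) : Module.Basis (Fin n) K (TruncDual K n) :=
  Pi.basisFun K (Fin n)

/-- `xᵢ`, with the convention `xᵢ = 0` for `i ≥ n`. -/
noncomputable def x (K : Type*) [Field K] (n i : ℕ) : TruncDual K n :=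
  if h : i < n then basis K n ⟨i, h⟩ else 0

/-- The coefficient of `x_k`, equal to `0` for `k ≥ n`. -/
noncomputable def coeff (k : ℕ) (c : TruncDual K n) : K :=
  if h : k < n then (basis K n).repr c ⟨k, h⟩ else 0

theorem basis_eq_x (i : Fin n) : basis K n i = x K n i := by
  simp [x]

/-- `Δ(xᵢ) = ∑_{j+k=i} x_j ⊗ x_k` and `ε(xᵢ) = δ_{i0}`. -/
noncomputable instance : CoalgebraStruct K (TruncDual K n) where
  comul := (basis K n).constr K fun i =>
    ∑ a ∈ Finset.HasAntidiagonal.antidiagonal (i : ℕ), x K n a.1 ⊗ₜ[K] x K n a.2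
  counit := (basis K n).constr K fun i => if (i : ℕ) = 0 then 1 else 0

theorem comul_x {i : ℕ} (hi : i < n) :
    Coalgebra.comul (R := K) (x K n i) =
      ∑ a ∈ Finset.HasAntidiagonal.antidiagonal i, x K n a.1 ⊗ₜ[K] x K n a.2 := by
  have : x K n i = basis K n ⟨i, hi⟩ := by simp [x, hi]
  rw [this]
  exact (basis K n).constr_basis K _ _

theorem counit_x {i : ℕ} (hi : i < n) :
    Coalgebra.counit (R := K) (x K n i) = if i = 0 then (1 : K) else 0 := by
  have : x K n i = basis K n ⟨i, hi⟩ := by simp [x, hi]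
  rw [this]
  exact (basis K n).constr_basis K _ _

noncomputable instance : Coalgebra K (TruncDual K n) where
  coassoc := by
    refine (basis K n).ext fun i => ?_
    simp only [basis_eq_x, LinearMap.comp_apply, comul_x i.2, map_sum, LinearMap.rTensor_tmul,
      LinearMap.lTensor_tmul, LinearEquiv.coe_coe]
    have h1 : ∀ a ∈ Finset.HasAntidiagonal.antidiagonal (i : ℕ),
        TensorProduct.assoc K _ _ _ (Coalgebra.comul (R := K) (x K n a.1) ⊗ₜ[K] x K n a.2) =
          ∑ b ∈ Finset.HasAntidiagonal.antidiagonal a.1, x K n b.1 ⊗ₜ[K] (x K n b.2 ⊗ₜ[K] x K n a.2) := by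
      intro a ha
      have := Finset.HasAntidiagonal.mem_antidiagonal.1 ha
      rw [comul_x (by omega), TensorProduct.sum_tmul, map_sum]
      rfl
    have h2 : ∀ a ∈ Finset.HasAntidiagonal.antidiagonal (i : ℕ),
        x K n a.1 ⊗ₜ[K] Coalgebra.comul (R := K) (x K n a.2) =
          ∑ b ∈ Finset.HasAntidiagonal.antidiagonal a.2, x K n a.1 ⊗ₜ[K] (x K n b.1 ⊗ₜ[K] x K n b.2) := by
      intro a ha
      have := Finset.HasAntidiagonal.mem_antidiagonal.1 ha
      rw [comul_x (by omega), TensorProduct.tmul_sum]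
    rw [Finset.sum_congr rfl h1, Finset.sum_congr rfl h2, Finset.sum_sigma', Finset.sum_sigma']
    refine Finset.sum_bij' (fun s _ => ⟨(s.2.1, s.2.2 + s.1.2), (s.2.2, s.1.2)⟩)
      (fun s _ => ⟨(s.1.1 + s.2.1, s.2.2), (s.1.1, s.2.1)⟩) ?_ ?_ ?_ ?_ ?_
    all_goals rintro ⟨⟨a, b⟩, ⟨c, d⟩⟩ h
    all_goals simp only [Finset.mem_sigma, Finset.HasAntidiagonal.mem_antidiagonal] at h ⊢
    all_goals obtain ⟨h3, h4⟩ := h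
    · exact ⟨by omega, trivial⟩
    · exact ⟨by omega, trivial⟩
    · subst h4; rfl
    · subst h4; rfl
  rTensor_counit_comp_comul := by
    refine (basis K n).ext fun i => ?_
    simp only [basis_eq_x, LinearMap.comp_apply, comul_x i.2, map_sum, LinearMap.rTensor_tmul,
      TensorProduct.mk_apply]
    rw [Finset.sum_eq_single (0, (i : ℕ))]
    · rw [counit_x (by have := i.2; omega)]; simp
    · rintro ⟨a, b⟩ hab hne
      have := Finset.HasAntidiagonal.mem_antidiagonal.1 hab
      have ha : a ≠ 0 := by
        rintro rfl
        exact hne (by simpa using this)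
      simp only at this ⊢
      rw [counit_x (by have := i.2; omega), if_neg ha, TensorProduct.zero_tmul]
    · intro h; exact absurd (by simp) h
  lTensor_counit_comp_comul := by
    refine (basis K n).ext fun i => ?_
    simp only [basis_eq_x, LinearMap.comp_apply, comul_x i.2, map_sum, LinearMap.lTensor_tmul,
      TensorProduct.mk_apply, LinearMap.flip_apply]
    rw [Finset.sum_eq_single ((i : ℕ), 0)]
    · rw [counit_x (by have := i.2; omega)]; simp
    · rintro ⟨a, b⟩ hab hne
      have := Finset.HasAntidiagonal.mem_antidiagonal.1 hab
      have hb : b ≠ 0 := by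
        rintro rfl
        exact hne (by simpa using this)
      simp only at this ⊢
      rw [counit_x (by have := i.2; omega), if_neg hb, TensorProduct.tmul_zero]
    · intro h; exact absurd (by simp) h

/-- Evaluation at the class of a polynomial in `K[y]/(yⁿ)`. -/
noncomputable def eval (P : Polynomial K) : TruncDual K n →ₗ[K] K :=
  (basis K n).constr K fun i => P.coeff i

/-- `Δ` is the transpose of the multiplication. -/
theorem eval_mul (P Q : Polynomial K) (c : TruncDual K n) :
    eval (P * Q) c =
      LinearMap.mul' K K (TensorProduct.map (eval P) (eval Q) (Coalgebra.comul (R := K) c)) := by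
  have hx : ∀ (R : Polynomial K) (j : ℕ), j < n → eval R (x K n j) = R.coeff j := by
    intro R j hj
    have : x K n j = basis K n ⟨j, hj⟩ := by simp [x, hj]
    rw [this]
    exact (basis K n).constr_basis K _ _
  suffices h : (eval (P * Q) : TruncDual K n →ₗ[K] K) =
      LinearMap.mul' K K ∘ₗ TensorProduct.map (eval P) (eval Q) ∘ₗ Coalgebra.comul (R := K) from
    LinearMap.congr_fun h c
  refine (basis K n).ext fun i => ?_
  simp only [basis_eq_x, LinearMap.comp_apply, comul_x i.2, map_sum, TensorProduct.map_tmul,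
    LinearMap.mul'_apply]
  rw [hx _ _ i.2, Polynomial.coeff_mul]
  refine Finset.sum_congr rfl fun a ha => ?_
  have := Finset.HasAntidiagonal.mem_antidiagonal.1 ha
  have := i.2
  rw [hx _ _ (by omega), hx _ _ (by omega)]

/-- The counit is the evaluation at `1`. -/
theorem eval_one : (eval 1 : TruncDual K n →ₗ[K] K) = Coalgebra.counit := by
  refine (basis K n).ext fun i => ?_
  rw [eval, Module.Basis.constr_basis, basis_eq_x, counit_x i.2, Polynomial.coeff_one]

/-- The structure coefficient `m_{ij}^k`: the coefficient of `x_k` in `m(x_i ⊗ x_j)`. -/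
noncomputable def structCoeff
    (m : TruncDual K n ⊗[K] TruncDual K n →ₗc[K] TruncDual K n) (i j k : ℕ) : K :=
  coeff k (m (x K n i ⊗ₜ[K] x K n j))

/-- The linear map `xᵢ ↦ λⁱ xᵢ`. -/
noncomputable def rescaleLin (K : Type*) [Field K] (n : ℕ) (lam : K) :
    TruncDual K n →ₗ[K] TruncDual K n :=
  (basis K n).constr K fun i => lam ^ (i : ℕ) • x K n i

theorem rescaleLin_x (lam : K) (i : ℕ) :
    rescaleLin K n lam (x K n i) = lam ^ i • x K n i := by
  by_cases hi : i < n
  · have : x K n i = basis K n ⟨i, hi⟩ := by simp [x, hi]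
    rw [this, rescaleLin, Module.Basis.constr_basis, ← this]
  · simp [x, hi]

/-- `xᵢ ↦ λⁱ xᵢ` as a coalgebra map. -/
noncomputable def rescaleHom (K : Type*) [Field K] (n : ℕ) (lam : K) :
    TruncDual K n →ₗc[K] TruncDual K n where
  __ := rescaleLin K n lam
  counit_comp := by
    refine (basis K n).ext fun i => ?_
    simp only [basis_eq_x, LinearMap.comp_apply, rescaleLin_x, map_smul, counit_x i.2]
    by_cases h : (i : ℕ) = 0 <;> simp [h]
  map_comp_comul := by
    refine (basis K n).ext fun i => ?_
    simp only [basis_eq_x, LinearMap.comp_apply, rescaleLin_x, map_smul, comul_x i.2, map_sum,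
      TensorProduct.map_tmul, Finset.smul_sum]
    refine Finset.sum_congr rfl fun a ha => ?_
    rw [TensorProduct.smul_tmul_smul, ← pow_add, Finset.HasAntidiagonal.mem_antidiagonal.1 ha]

/-- The coalgebra automorphism `f_λ`, `f_λ(xᵢ) = λⁱ xᵢ`, for `λ ∈ Kˣ`. -/
noncomputable def rescale (K : Type*) [Field K] (n : ℕ) (lam : Kˣ) :
    TruncDual K n ≃ₗc[K] TruncDual K n where
  __ := rescaleHom K n lam
  invFun := rescaleHom K n (lam⁻¹ : Kˣ)
  left_inv c := by
    have h : rescaleLin K n (lam⁻¹ : Kˣ) ∘ₗ rescaleLin K n lam = LinearMap.id := by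
      refine (basis K n).ext fun i => ?_
      simp [basis_eq_x, rescaleLin_x, smul_smul]
    exact LinearMap.congr_fun h c
  right_inv c := by
    have h : rescaleLin K n lam ∘ₗ rescaleLin K n (lam⁻¹ : Kˣ) = LinearMap.id := by
      refine (basis K n).ext fun i => ?_
      simp [basis_eq_x, rescaleLin_x, smul_smul]
    exact LinearMap.congr_fun h c

theorem rescale_x (lam : Kˣ) (i : ℕ) :
    rescale K n lam (x K n i) = (lam : K) ^ i • x K n i :=
  rescaleLin_x _ _

end TruncDual

/-! ### Standard cycle coalgebras -/

namespace Standard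

open PowerSeries

variable {K : Type*} [Field K]

/-- `f = 1 + ∑_{v₀ ≤ v < n} p_v x^v` with `v₀ > 0` and `p_{v₀} = 1`. -/
structure IsParameter (n v₀ : ℕ) (f : K⟦X⟧) : Prop where
  pos : 0 < v₀
  coeff_zero : coeff 0 f = 1
  coeff_lt : ∀ v, 0 < v → v < v₀ → coeff v f = 0
  coeff_deg : coeff v₀ f = 1
  coeff_ge : ∀ v, n ≤ v → coeff v f = 0

/-- `φ / x^m`, for a series `φ` divisible by `x^m`. -/
noncomputable def shift (m : ℕ) (φ : K⟦X⟧) : K⟦X⟧ := PowerSeries.mk fun k => coeff (k + m) φ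

theorem X_pow_mul_shift {m : ℕ} {φ : K⟦X⟧} (h : ∀ k < m, coeff k φ = 0) :
    X ^ m * shift m φ = φ := by
  ext k
  rw [coeff_X_pow_mul']
  split_ifs with hk
  · simp [shift, Nat.sub_add_cancel hk]
  · exact (h k (by omega)).symm

/-- `g = f (f^{v₀} - 1) / f'`; numerator and denominator are first divided by `x^{v₀-1}`, after
which the denominator is invertible. -/
noncomputable def g (v₀ : ℕ) (f : K⟦X⟧) : K⟦X⟧ :=
  shift (v₀ - 1) (f * (f ^ v₀ - 1)) * (shift (v₀ - 1) (derivative K f))⁻¹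

theorem g_mul_derivative [CharZero K] {n v₀ : ℕ} {f : K⟦X⟧} (hf : IsParameter n v₀ f) :
    g v₀ f * derivative K f = f * (f ^ v₀ - 1) := by
  have hd : ∀ k < v₀ - 1, coeff k (derivative K f) = 0 := by
    intro k hk
    rw [coeff_derivative, hf.coeff_lt _ (by omega) (by omega), zero_mul]
  have h1 : (X : K⟦X⟧) ^ v₀ ∣ f - 1 := by
    rw [X_pow_dvd_iff]
    intro k hk
    rcases Nat.eq_zero_or_pos k with rfl | hk0
    · simpa [sub_eq_zero] using hf.coeff_zero
    · simp [hf.coeff_lt k hk0 hk, coeff_one, hk0.ne']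
  have h2 : (X : K⟦X⟧) ^ v₀ ∣ f * (f ^ v₀ - 1) :=
    (h1.trans (by simpa using sub_dvd_pow_sub_pow f 1 v₀)).mul_left f
  have hn : ∀ k < v₀ - 1, coeff k (f * (f ^ v₀ - 1)) = 0 := fun k hk =>
    (X_pow_dvd_iff.1 h2) k (by omega)
  have hc : constantCoeff (shift (v₀ - 1) (derivative K f)) ≠ 0 := by
    have hv : v₀ - 1 + 1 = v₀ := Nat.sub_add_cancel hf.pos
    rw [← coeff_zero_eq_constantCoeff_apply, shift, coeff_mk, zero_add, coeff_derivative, hv,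
      hf.coeff_deg, one_mul]
    have : ((v₀ : ℕ) : K) ≠ 0 := Nat.cast_ne_zero.2 hf.pos.ne'
    have h2 : ((v₀ - 1 : ℕ) : K) + 1 = (v₀ : K) := by exact_mod_cast congrArg (Nat.cast (R := K)) hv
    rwa [h2]
  calc g v₀ f * derivative K f
      = g v₀ f * (X ^ (v₀ - 1) * shift (v₀ - 1) (derivative K f)) := by rw [X_pow_mul_shift hd]
    _ = X ^ (v₀ - 1) * shift (v₀ - 1) (f * (f ^ v₀ - 1)) *
          ((shift (v₀ - 1) (derivative K f))⁻¹ * shift (v₀ - 1) (derivative K f)) := by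
        rw [g]; ring
    _ = f * (f ^ v₀ - 1) := by rw [X_pow_mul_shift hn, PowerSeries.inv_mul_cancel _ hc, mul_one]

/-- The series `g_v(x)`: `g₀ = x` and, with `f = ∑ p_v x^v`,
`(v+1) g_{v+1} = g ∑_{l=0}^{v} (v+1-l) p_{v+1-l} g_l' - ∑_{l=0}^{v} l p_{v+1-l} g_l`. -/
noncomputable def gSeq (v₀ : ℕ) (f : K⟦X⟧) : ℕ → K⟦X⟧
  | 0 => X
  | v + 1 => C ((v + 1 : K)⁻¹) *
      (g v₀ f * ∑ l : Fin (v + 1), C (((v + 1 - l.1 : ℕ) : K) * coeff (v + 1 - l.1) f) *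
          derivative K (gSeq v₀ f l.1) -
        ∑ l : Fin (v + 1), C ((l.1 : K) * coeff (v + 1 - l.1) f) * gSeq v₀ f l.1)
decreasing_by all_goals exact l.2

/-- `G(x, y) = ∑_v g_v(x) y^v ∈ K[[x]][[y]]`. -/
noncomputable def G (v₀ : ℕ) (f : K⟦X⟧) : K⟦X⟧⟦X⟧ := PowerSeries.mk (gSeq v₀ f)

/-- The derivative with respect to the inner variable `x` of a series in `K[[x]][[y]]`. -/
noncomputable def derivX (H : K⟦X⟧⟦X⟧) : K⟦X⟧⟦X⟧ :=
  PowerSeries.mk fun v => derivative K (coeff v H)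

/-- `G(x, 0) = x` and `G_y = g(x) f'(y) G_x - (f(y) - 1) G_y`. -/
theorem G_spec [CharZero K] {n v₀ : ℕ} {f : K⟦X⟧} (hf : IsParameter n v₀ f) :
    coeff 0 (G v₀ f) = X ∧
    derivative K⟦X⟧ (G v₀ f) =
      C (g v₀ f) * PowerSeries.map C (derivative K f) * derivX (G v₀ f) -
        PowerSeries.map C (f - 1) * derivative K⟦X⟧ (G v₀ f) := by
  refine ⟨by rw [G, coeff_mk, gSeq], ?_⟩
  ext1 v
  have hv : (C ((v : K) + 1) : K⟦X⟧) * C ((v + 1 : K)⁻¹) = 1 := by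
    rw [← map_mul, mul_inv_cancel₀ (by exact_mod_cast Nat.succ_ne_zero v), map_one]
  have hL : coeff v (derivative K⟦X⟧ (G v₀ f)) =
      g v₀ f * ∑ l ∈ Finset.range (v + 1), C (((v + 1 - l : ℕ) : K) * coeff (v + 1 - l) f) *
          derivative K (gSeq v₀ f l) -
        ∑ l ∈ Finset.range (v + 1), C ((l : K) * coeff (v + 1 - l) f) * gSeq v₀ f l := by
    rw [coeff_derivative, G, coeff_mk, gSeq, Finset.sum_range, Finset.sum_range]
    have : ((v : K⟦X⟧) + 1) = C ((v : K) + 1) := by simp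
    rw [this, mul_comm, ← mul_assoc, hv, one_mul]
  rw [hL, map_sub, mul_assoc, coeff_C_mul, coeff_mul, coeff_mul]
  congr 1
  · congr 1
    rw [← Finset.Nat.sum_antidiagonal_swap,
      Finset.Nat.sum_antidiagonal_eq_sum_range_succ_mk]
    refine Finset.sum_congr rfl fun l hl => ?_
    have hl' : v - l + 1 = v + 1 - l := by have := Finset.mem_range.1 hl; omega
    simp only [derivX, G, coeff_derivative, coeff_mk, coeff_map, Prod.fst_swap, Prod.snd_swap, hl']
    congr 2
    rw [← hl', Nat.cast_succ, mul_comm]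
  · rw [← Finset.Nat.sum_antidiagonal_swap,
      Finset.Nat.sum_antidiagonal_eq_sum_range_succ_mk, Finset.sum_range_succ',
      Finset.sum_range_succ]
    have h0 : coeff 0 (PowerSeries.map (C : K →+* K⟦X⟧) (f - 1)) = 0 := by
      rw [coeff_map, map_sub, hf.coeff_zero, coeff_zero_one, sub_self, map_zero]
    simp only [Prod.fst_swap, Prod.snd_swap, Nat.sub_self, h0, zero_mul, add_zero, Nat.cast_zero,
      map_zero]
    refine Finset.sum_congr rfl fun l hl => ?_
    have hl' : v + 1 - (l + 1) = v - l := by omega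
    have hl2 : v - l ≠ 0 := by have := Finset.mem_range.1 hl; omega
    rw [hl', coeff_map, map_sub, coeff_one, if_neg hl2, sub_zero, coeff_derivative, G, coeff_mk,
      map_mul, map_natCast, Nat.cast_succ]
    ring

/-- The coefficients `p_{uv}^w`: `p_{uv}^0 = δ_{0,u+v}`, `G = ∑ p_{uv}^1 x^u y^v`, and
`p_{uv}^w = ∑ p_{u₁v₁}^1 p_{u₂v₂}^{w-1}` (`u₁+u₂=u`, `v₁+v₂=v`) for `w > 1`. -/
noncomputable def pCoeff (v₀ : ℕ) (f : K⟦X⟧) : ℕ → ℕ → ℕ → K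
  | u, v, 0 => if u + v = 0 then 1 else 0
  | u, v, 1 => coeff u (coeff v (G v₀ f))
  | u, v, w + 2 => ∑ a ∈ Finset.HasAntidiagonal.antidiagonal u, ∑ b ∈ Finset.HasAntidiagonal.antidiagonal v,
      coeff a.1 (coeff b.1 (G v₀ f)) * pCoeff v₀ f a.2 b.2 (w + 1)

/-- `(C, q)` is the standard cycle coalgebra of degree `v₀` associated with `f`, where `C` is the
dual coalgebra of `K[y]/(yⁿ)`. -/
def IsSCC (n v₀ : ℕ) (f : K⟦X⟧)
    (q : TruncDual K n ⊗[K] TruncDual K n →ₗc[K] TruncDual K n) : Prop :=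
  IsParameter n v₀ f ∧
  ∀ i j k : ℕ, i < n → j < n → k < n → TruncDual.structCoeff q i j k = pCoeff v₀ f i j k

end Standard

/-! A coalgebra morphism `m : C ⊗ C → C` is the transpose of an algebra map from K[y]/(yⁿ) to
K[x,y]/(xⁿ,yⁿ). It therefore amounts to one truncated series m(x,y) = ∑ m_{ij}^1 x^i y^j with mⁿ =
0, and it acts on pairs of elements of n-th power zero in any commutative K-algebra (`evalPt`). On
such points the first two axioms read p(p(a,b), d(c,b)) = p(p(a,c), p(b,c)) and d(p(a,b), p(c,b)) =
p(d(a,c), d(b,c)), and dual numbers allow them to be differentiated.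

Regularity gives p_{10}^1 ≠ 0, and then pⁿ = 0 in characteristic zero forces p(0,y) = 0
(`structCoeff_zero_left`); likewise for d. Linearizing the first identity at a = 0 and using
p_{11}^1 ≠ 0 yields p(x,0) = x = d(x,0). Put γ(x) = p_y(x,0), f(y) = p_x(0,y), h(y) = d_x(0,y). The
parts of the two identities linear in a third variable say that P = p and P = d both satisfy h(y)
γ(P) = γ(x) P_x + γ(y) P_y.

After rescaling to p_{11}^1 = 1, the terms of these equations linear in x are hf = f + γf' and hh =
h + γh'. They force h = f (`X_pow_dvd_sub_of_dvd`), hence γf' = f(f-1), so γ is g up to order n. In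
`sub_G_mem_truncIdeal`, E = γ(P) - γ(x) P_x satisfies an Euler-type equation whose nonzero solutions
start in degree 1; E has no term of degree 1, so E = 0. What remains is γ(y) P_y = (f(y)-1) γ(x) P_x
with P(x,0) = x, which is the equation defining G. Thus p = d = G up to truncation.

Uniqueness holds because the coefficient of x in G is f(y) (`coeff_one_coeff_G`): the structure
constants recover f, and its linear coefficient 1 fixes the scaling. Once d = p, the solution acts
on points by (s,t) ↦ (t · sᵗ, sᵗ), and the inverse relations between p and a ↦ aᵇ make its square
the identity. -/

section Transport

/-! ### Transport of structure along a coalgebra automorphism. -/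

variable {K C : Type*} [Field K] [AddCommGroup C] [Module K C] [Coalgebra K C]

theorem CoalgEquiv.map_comul_apply (e : C ≃ₗc[K] C) (b : C) :
    TensorProduct.map (e : C →ₗ[K] C) (e : C →ₗ[K] C) (Coalgebra.comul (R := K) b) =
      Coalgebra.comul (R := K) (e b) :=
  CoalgHomClass.map_comp_comul_apply e b

/-- Since `e` commutes with the comultiplication, a Sweedler expression is natural in its three
maps; every axiom is transported by this lemma and its opposite version. -/
theorem sweedler_conj (e : C ≃ₗc[K] C) {m m' : C ⊗[K] C →ₗ[K] C} {φ φ' ψ ψ' : C →ₗ[K] C}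
    (hm : ∀ a b, e (m (a ⊗ₜ b)) = m' (e a ⊗ₜ e b)) (hφ : ∀ a, φ' (e a) = e (φ a))
    (hψ : ∀ a, ψ' (e a) = e (ψ a)) (b : C) :
    sweedler m' φ' ψ' (e b) = e (sweedler m φ ψ b) := by
  unfold sweedler
  rw [← CoalgEquiv.map_comul_apply]
  generalize Coalgebra.comul (R := K) b = t
  induction t with
  | zero => simp
  | tmul u v => simp [hm, hφ, hψ]
  | add u v hu hv => simp only [map_add, hu, hv]

theorem sweedlerOp_conj (e : C ≃ₗc[K] C) {m m' : C ⊗[K] C →ₗ[K] C} {φ φ' ψ ψ' : C →ₗ[K] C}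
    (hm : ∀ a b, e (m (a ⊗ₜ b)) = m' (e a ⊗ₜ e b)) (hφ : ∀ a, φ' (e a) = e (φ a))
    (hψ : ∀ a, ψ' (e a) = e (ψ a)) (b : C) :
    sweedlerOp m' φ' ψ' (e b) = e (sweedlerOp m φ ψ b) := by
  unfold sweedlerOp
  rw [← CoalgEquiv.map_comul_apply]
  generalize Coalgebra.comul (R := K) b = t
  induction t with
  | zero => simp
  | tmul u v => simp [hm, hφ, hψ]
  | add u v hu hv => simp only [map_add, hu, hv]

/-- The transport of a multiplication along a coalgebra automorphism. -/
noncomputable def conjMul (e : C ≃ₗc[K] C) (m : C ⊗[K] C →ₗc[K] C) : C ⊗[K] C →ₗc[K] C :=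
  (e : C →ₗc[K] C).comp (m.comp
    (Coalgebra.TensorProduct.map (e.symm : C →ₗc[K] C) (e.symm : C →ₗc[K] C)))

theorem conjMul_tmul (e : C ≃ₗc[K] C) (m : C ⊗[K] C →ₗc[K] C) (a b : C) :
    conjMul e m (a ⊗ₜ b) = e (m (e.symm a ⊗ₜ e.symm b)) := by
  simp [conjMul]

theorem conjMul_apply (e : C ≃ₗc[K] C) (m : C ⊗[K] C →ₗc[K] C) (a b : C) :
    e (m (a ⊗ₜ b)) = conjMul e m (e a ⊗ₜ e b) := by
  simp [conjMul_tmul]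

theorem leftArg_conjMul (e : C ≃ₗc[K] C) (m : C ⊗[K] C →ₗc[K] C) (a b : C) :
    leftArg (conjMul e m).toLinearMap (e a) (e b) = e (leftArg m.toLinearMap a b) :=
  (conjMul_apply e m a b).symm

theorem IsInverseAction.conjMul (e : C ≃ₗc[K] C) {p r : C ⊗[K] C →ₗc[K] C}
    (h : IsInverseAction p.toLinearMap r.toLinearMap) :
    IsInverseAction (conjMul e p).toLinearMap (conjMul e r).toLinearMap := by
  intro a b
  obtain ⟨a, rfl⟩ := EquivLike.surjective e a
  obtain ⟨b, rfl⟩ := EquivLike.surjective e b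
  rw [sweedler_conj e (conjMul_apply e p) (leftArg_conjMul e r a)
      (ψ := LinearMap.id) (ψ' := LinearMap.id) (fun _ => rfl),
    sweedler_conj e (conjMul_apply e r) (leftArg_conjMul e p a)
      (ψ := LinearMap.id) (ψ' := LinearMap.id) (fun _ => rfl),
    (h a b).1, (h a b).2]
  have hc : Coalgebra.counit (R := K) (e b) = Coalgebra.counit (R := K) b :=
    CoalgHomClass.counit_comp_apply e b
  simp [hc]

theorem IsInverseActionOp.conjMul (e : C ≃ₗc[K] C) {p r : C ⊗[K] C →ₗc[K] C}
    (h : IsInverseActionOp p.toLinearMap r.toLinearMap) :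
    IsInverseActionOp (conjMul e p).toLinearMap (conjMul e r).toLinearMap := by
  intro a b
  obtain ⟨a, rfl⟩ := EquivLike.surjective e a
  obtain ⟨b, rfl⟩ := EquivLike.surjective e b
  rw [sweedlerOp_conj e (conjMul_apply e r) (leftArg_conjMul e p a)
      (ψ := LinearMap.id) (ψ' := LinearMap.id) (fun _ => rfl),
    sweedlerOp_conj e (conjMul_apply e p) (leftArg_conjMul e r a)
      (ψ := LinearMap.id) (ψ' := LinearMap.id) (fun _ => rfl),
    (h a b).1, (h a b).2]
  have hc : Coalgebra.counit (R := K) (e b) = Coalgebra.counit (R := K) b :=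
    CoalgHomClass.counit_comp_apply e b
  simp [hc]

theorem IsRegularQCycleCoalgebra.conjMul (e : C ≃ₗc[K] C) {p d : C ⊗[K] C →ₗc[K] C}
    (h : IsRegularQCycleCoalgebra p d) :
    IsRegularQCycleCoalgebra (conjMul e p) (conjMul e d) where
  regular := by
    obtain ⟨⟨r, hr⟩, ⟨t, ht⟩⟩ := h.regular
    exact ⟨⟨_, hr.conjMul e⟩, ⟨_, ht.conjMul e⟩⟩
  cycle₁ a b c := by
    obtain ⟨a, rfl⟩ := EquivLike.surjective e a
    obtain ⟨b, rfl⟩ := EquivLike.surjective e b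
    obtain ⟨c, rfl⟩ := EquivLike.surjective e c
    rw [sweedler_conj e (conjMul_apply e p) (leftArg_conjMul e p a) (leftArg_conjMul e d c),
      sweedlerOp_conj e (conjMul_apply e p) (leftArg_conjMul e p a) (leftArg_conjMul e p b),
      h.cycle₁]
  cycle₂ a b c := by
    obtain ⟨a, rfl⟩ := EquivLike.surjective e a
    obtain ⟨b, rfl⟩ := EquivLike.surjective e b
    obtain ⟨c, rfl⟩ := EquivLike.surjective e c
    rw [sweedler_conj e (conjMul_apply e d) (leftArg_conjMul e p a) (leftArg_conjMul e p c),
      sweedlerOp_conj e (conjMul_apply e p) (leftArg_conjMul e d a) (leftArg_conjMul e d b),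
      h.cycle₂]
  cycle₃ a b c := by
    obtain ⟨a, rfl⟩ := EquivLike.surjective e a
    obtain ⟨b, rfl⟩ := EquivLike.surjective e b
    obtain ⟨c, rfl⟩ := EquivLike.surjective e c
    rw [sweedler_conj e (conjMul_apply e d) (leftArg_conjMul e d a) (leftArg_conjMul e d c),
      sweedlerOp_conj e (conjMul_apply e d) (leftArg_conjMul e d a) (leftArg_conjMul e p b),
      h.cycle₃]

end Transport

/-! ### Coalgebra morphisms as truncated power series. -/

/-- Terms of total degree at least n die, so truncated series multiply at t by the Cauchy product.
-/
theorem sum_range_mul_sum_range_of_pow_eq_zero {R : Type*} [CommSemiring R] {t : R} {n : ℕ}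
    (ht : t ^ n = 0) (u v : ℕ → R) :
    (∑ i ∈ Finset.range n, u i * t ^ i) * (∑ j ∈ Finset.range n, v j * t ^ j) =
      ∑ j ∈ Finset.range n,
        (∑ a ∈ Finset.HasAntidiagonal.antidiagonal j, u a.1 * v a.2) * t ^ j := by
  have ht' : ∀ m, n ≤ m → t ^ m = 0 := fun m hm => pow_eq_zero_of_le hm ht
  rw [Finset.sum_mul_sum, ← Finset.sum_product']
  rw [← Finset.sum_filter_of_ne (p := fun a : ℕ × ℕ => a.1 + a.2 < n)]
  · rw [← Finset.sum_fiberwise_of_maps_to (g := fun a : ℕ × ℕ => a.1 + a.2) (t := Finset.range n)]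
    · refine Finset.sum_congr rfl fun j hj => ?_
      rw [Finset.sum_mul]
      have hj' := Finset.mem_range.1 hj
      refine Finset.sum_congr ?_ fun a ha => ?_
      · ext a
        simp only [Finset.mem_filter, Finset.mem_product, Finset.mem_range,
          Finset.HasAntidiagonal.mem_antidiagonal]
        omega
      · rw [← Finset.HasAntidiagonal.mem_antidiagonal.1 ha, pow_add]; ring
    · intro a ha
      simpa using (Finset.mem_filter.1 ha).2
  · intro a _ ha
    by_contra hlt
    apply ha
    calc u a.1 * t ^ a.1 * (v a.2 * t ^ a.2) = u a.1 * v a.2 * t ^ (a.1 + a.2) := by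
          rw [pow_add]; ring
      _ = 0 := by rw [ht' _ (not_lt.1 hlt), mul_zero]

namespace TruncDual

variable {K : Type*} [Field K] {n : ℕ}

/-- The coefficient of `x_k` as a linear form. -/
noncomputable def coeffLin (k : ℕ) : TruncDual K n →ₗ[K] K :=
  if h : k < n then (basis K n).coord ⟨k, h⟩ else 0

theorem coeffLin_apply (k : ℕ) (c : TruncDual K n) : coeffLin k c = coeff k c := by
  unfold coeffLin coeff
  split_ifs <;> simp

theorem coeff_x {i : ℕ} (hi : i < n) (k : ℕ) :
    coeff k (x K n i) = if i = k then 1 else 0 := by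
  by_cases hk : k < n
  · have : x K n i = basis K n ⟨i, hi⟩ := by simp [x, hi]
    rw [coeff, dif_pos hk, this, Module.Basis.repr_self, Finsupp.single_apply]
    simp
  · rw [coeff, dif_neg hk, if_neg (by omega)]

theorem x_of_le {i : ℕ} (hi : n ≤ i) : x K n i = 0 := by
  rw [x, dif_neg (by omega)]

theorem coeff_of_le {k : ℕ} (hk : n ≤ k) (c : TruncDual K n) : coeff k c = 0 := by
  rw [coeff, dif_neg (by omega)]

theorem sum_coeff_smul_x (c : TruncDual K n) :
    ∑ k ∈ Finset.range n, coeff k c • x K n k = c := by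
  conv_rhs => rw [← (basis K n).sum_repr c]
  rw [Finset.sum_range]
  refine Finset.sum_congr rfl fun i _ => ?_
  rw [coeff, dif_pos i.2, basis_eq_x]

theorem ext_coeff {c c' : TruncDual K n} (h : ∀ k < n, coeff k c = coeff k c') : c = c' := by
  rw [← sum_coeff_smul_x c, ← sum_coeff_smul_x c']
  exact Finset.sum_congr rfl fun k hk => by rw [h k (Finset.mem_range.1 hk)]

theorem linearMap_ext {V : Type*} [AddCommGroup V] [Module K V] {φ ψ : TruncDual K n →ₗ[K] V}
    (h : ∀ i < n, φ (x K n i) = ψ (x K n i)) : φ = ψ :=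
  (basis K n).ext fun i => by rw [basis_eq_x]; exact h i i.2

theorem tensor_ext {V : Type*} [AddCommGroup V] [Module K V]
    {φ ψ : TruncDual K n ⊗[K] TruncDual K n →ₗ[K] V}
    (h : ∀ i < n, ∀ j < n, φ (x K n i ⊗ₜ x K n j) = ψ (x K n i ⊗ₜ x K n j)) : φ = ψ := by
  refine TensorProduct.ext ?_
  refine linearMap_ext fun i hi => linearMap_ext fun j hj => ?_
  exact h i hi j hj

/-- The coordinate forms are the classes of the powers of y, and this is y^k y^l = y^{k+l}. Indices
beyond n are harmless, since those forms are zero by convention. -/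
theorem mul'_map_coeffLin_comul (k l : ℕ) (c : TruncDual K n) :
    LinearMap.mul' K K (TensorProduct.map (coeffLin k) (coeffLin l)
      (Coalgebra.comul (R := K) c)) = coeffLin (k + l) c := by
  suffices h : LinearMap.mul' K K ∘ₗ TensorProduct.map (coeffLin k) (coeffLin l) ∘ₗ
      Coalgebra.comul (R := K) = (coeffLin (k + l) : TruncDual K n →ₗ[K] K) from
    LinearMap.congr_fun h c
  refine linearMap_ext fun i hi => ?_
  simp only [LinearMap.comp_apply, comul_x hi, map_sum, TensorProduct.map_tmul,
    LinearMap.mul'_apply, coeffLin_apply, coeff_x hi]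
  have : ∀ a ∈ Finset.HasAntidiagonal.antidiagonal i, coeff k (x K n a.1) * coeff l (x K n a.2) =
      if a = (k, l) then 1 else 0 := by
    intro a ha
    have := Finset.HasAntidiagonal.mem_antidiagonal.1 ha
    rw [coeff_x (by omega), coeff_x (by omega)]
    rcases a with ⟨a, b⟩
    simp only [Prod.mk.injEq]
    split_ifs <;> simp_all
  rw [Finset.sum_congr rfl this, Finset.sum_ite_eq']
  simp only [Finset.HasAntidiagonal.mem_antidiagonal]
  split_ifs <;> first | rfl | omega

theorem structCoeff_zero (m : TruncDual K n ⊗[K] TruncDual K n →ₗc[K] TruncDual K n) {i j : ℕ}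
    (hi : i < n) (hj : j < n) : structCoeff m i j 0 = if i + j = 0 then 1 else 0 := by
  have h0 : ∀ c : TruncDual K n, coeff 0 c = Coalgebra.counit (R := K) c := by
    intro c
    suffices h : (coeffLin 0 : TruncDual K n →ₗ[K] K) = Coalgebra.counit by
      rw [← h, coeffLin_apply]
    refine linearMap_ext fun i hi => ?_
    rw [coeffLin_apply, coeff_x hi, counit_x hi]
  rw [structCoeff, h0, CoalgHomClass.counit_comp_apply, TensorProduct.counit_tmul, counit_x hi,
    counit_x hj]
  by_cases h : i = 0 <;> by_cases h' : j = 0 <;> simp [h, h']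

/-- Compatibility with Δ, read in coordinates: the coordinate series of index k + l is the product
of those of index k and l. Hence all of them are powers of the first. -/
theorem structCoeff_add (m : TruncDual K n ⊗[K] TruncDual K n →ₗc[K] TruncDual K n) {i j : ℕ}
    (hi : i < n) (hj : j < n) (k l : ℕ) :
    structCoeff m i j (k + l) = ∑ a ∈ Finset.HasAntidiagonal.antidiagonal i,
      ∑ b ∈ Finset.HasAntidiagonal.antidiagonal j,
        structCoeff m a.1 b.1 k * structCoeff m a.2 b.2 l := by
  rw [structCoeff, ← coeffLin_apply, ← mul'_map_coeffLin_comul,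
    ← CoalgHomClass.map_comp_comul_apply, TensorProduct.comul_tmul, comul_x hi, comul_x hj]
  simp only [TensorProduct.sum_tmul, TensorProduct.tmul_sum, map_sum]
  rw [Finset.sum_comm]
  refine Finset.sum_congr rfl fun a _ => ?_
  refine Finset.sum_congr rfl fun b _ => ?_
  simp [structCoeff, coeffLin_apply]

theorem structCoeff_of_le_left (m : TruncDual K n ⊗[K] TruncDual K n →ₗc[K] TruncDual K n)
    {i : ℕ} (hi : n ≤ i) (j k : ℕ) : structCoeff m i j k = 0 := by
  rw [structCoeff, x_of_le hi, TensorProduct.zero_tmul, map_zero, ← coeffLin_apply, map_zero]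

theorem structCoeff_of_le_right (m : TruncDual K n ⊗[K] TruncDual K n →ₗc[K] TruncDual K n)
    (i : ℕ) {j : ℕ} (hj : n ≤ j) (k : ℕ) : structCoeff m i j k = 0 := by
  rw [structCoeff, x_of_le hj, TensorProduct.tmul_zero, map_zero, ← coeffLin_apply, map_zero]

theorem structCoeff_of_le (m : TruncDual K n ⊗[K] TruncDual K n →ₗc[K] TruncDual K n)
    (i j : ℕ) {k : ℕ} (hk : n ≤ k) : structCoeff m i j k = 0 := coeff_of_le hk _

theorem coeff_apply_tmul (m : TruncDual K n ⊗[K] TruncDual K n →ₗc[K] TruncDual K n)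
    (u v : TruncDual K n) (l : ℕ) :
    coeff l (m (u ⊗ₜ v)) = ∑ i ∈ Finset.range n, ∑ j ∈ Finset.range n,
      structCoeff m i j l * coeff i u * coeff j v := by
  conv_lhs => rw [← sum_coeff_smul_x u, ← sum_coeff_smul_x v]
  simp only [TensorProduct.sum_tmul, TensorProduct.tmul_sum, map_sum, ← coeffLin_apply]
  rw [Finset.sum_comm]
  refine Finset.sum_congr rfl fun a _ => ?_
  refine Finset.sum_congr rfl fun b _ => ?_
  simp only [TensorProduct.smul_tmul_smul, map_smul, smul_eq_mul, structCoeff, coeffLin_apply]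
  ring

/-! ### Evaluation at points of a commutative algebra -/

variable {R : Type*} [CommRing R] [Algebra K R]

/-- `∑ F_{ij} s^i t^j`, the sum being over `i, j < n`. -/
noncomputable def evalArray (n : ℕ) (F : ℕ → ℕ → K) (s t : R) : R :=
  ∑ i ∈ Finset.range n, ∑ j ∈ Finset.range n, algebraMap K R (F i j) * s ^ i * t ^ j

theorem evalArray_conv (F G : ℕ → ℕ → K) {s t : R} (hs : s ^ n = 0) (ht : t ^ n = 0) :
    evalArray n (fun i j => ∑ a ∈ Finset.HasAntidiagonal.antidiagonal i,
      ∑ b ∈ Finset.HasAntidiagonal.antidiagonal j, F a.1 b.1 * G a.2 b.2) s t =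
      evalArray n F s t * evalArray n G s t := by
  have h : ∀ F : ℕ → ℕ → K, evalArray n F s t = ∑ i ∈ Finset.range n,
      (∑ j ∈ Finset.range n, algebraMap K R (F i j) * t ^ j) * s ^ i := by
    intro F
    refine Finset.sum_congr rfl fun i _ => ?_
    rw [Finset.sum_mul]
    exact Finset.sum_congr rfl fun j _ => by ring
  rw [h, h F, h G, sum_range_mul_sum_range_of_pow_eq_zero hs]
  refine Finset.sum_congr rfl fun i hi => ?_
  congr 1
  simp only [sum_range_mul_sum_range_of_pow_eq_zero ht]
  rw [Finset.sum_comm]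
  refine Finset.sum_congr rfl fun j hj => ?_
  rw [map_sum, Finset.sum_mul]
  refine Finset.sum_congr rfl fun a _ => ?_
  simp only [map_sum, map_mul]

/-- `∑ m_{ij}^k s^i t^j`. -/
noncomputable def evalPow (m : TruncDual K n ⊗[K] TruncDual K n →ₗc[K] TruncDual K n) (k : ℕ)
    (s t : R) : R :=
  ∑ i ∈ Finset.range n, ∑ j ∈ Finset.range n,
    algebraMap K R (structCoeff m i j k) * s ^ i * t ^ j

/-- The value at the point `(s, t)` of the series `∑ m_{ij}^1 x^i y^j`. -/
noncomputable def evalPt (m : TruncDual K n ⊗[K] TruncDual K n →ₗc[K] TruncDual K n)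
    (s t : R) : R := evalPow m 1 s t

variable (m : TruncDual K n ⊗[K] TruncDual K n →ₗc[K] TruncDual K n)

theorem evalPow_add {s t : R} (hs : s ^ n = 0) (ht : t ^ n = 0) (k l : ℕ) :
    evalPow m (k + l) s t = evalPow m k s t * evalPow m l s t := by
  refine Eq.trans ?_ (evalArray_conv (n := n) (fun i j => structCoeff m i j k)
    (fun i j => structCoeff m i j l) hs ht)
  refine Finset.sum_congr rfl fun i hi => Finset.sum_congr rfl fun j hj => ?_
  rw [structCoeff_add m (Finset.mem_range.1 hi) (Finset.mem_range.1 hj)]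

theorem evalPow_zero (hn : 0 < n) (s t : R) : evalPow m 0 s t = 1 := by
  unfold evalPow
  rw [Finset.sum_eq_single 0, Finset.sum_eq_single 0]
  · simp [structCoeff_zero m hn hn]
  · intro j hj hj0
    simp [structCoeff_zero m hn (Finset.mem_range.1 hj), hj0]
  · intro h; exact absurd (Finset.mem_range.2 hn) h
  · intro i hi hi0
    refine Finset.sum_eq_zero fun j hj => ?_
    simp [structCoeff_zero m (Finset.mem_range.1 hi) (Finset.mem_range.1 hj), hi0]
  · intro h; exact absurd (Finset.mem_range.2 hn) h

theorem evalPow_eq_pow (hn : 0 < n) {s t : R} (hs : s ^ n = 0) (ht : t ^ n = 0) (k : ℕ) :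
    evalPow m k s t = evalPt m s t ^ k := by
  induction k with
  | zero => rw [evalPow_zero m hn, pow_zero]
  | succ k ih => rw [evalPow_add m hs ht, ih, pow_succ, evalPt]

/-- There is no basis vector of index n, so the n-th coordinate series is zero. This makes points
closed under `m`, so that values can be composed. -/
theorem evalPt_pow_eq_zero (hn : 0 < n) {s t : R} (hs : s ^ n = 0) (ht : t ^ n = 0) :
    evalPt m s t ^ n = 0 := by
  rw [← evalPow_eq_pow m hn hs ht, evalPow]
  simp [structCoeff_of_le m _ _ le_rfl]

end TruncDual

/-! ### The axioms as identities between points. -/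

namespace TruncDual

variable {K : Type*} [Field K] {n : ℕ} {R : Type*} [CommRing R] [Algebra K R]

/-- The value at `t` of the generating series of the coordinates `l` of `φ(x_j)`. -/
noncomputable def evalLin (φ : TruncDual K n →ₗ[K] TruncDual K n) (l : ℕ) (t : R) : R :=
  ∑ j ∈ Finset.range n, algebraMap K R (coeff l (φ (x K n j))) * t ^ j

theorem evalLin_id {l : ℕ} (hl : l < n) (t : R) :
    evalLin (LinearMap.id : TruncDual K n →ₗ[K] TruncDual K n) l t = t ^ l := by
  unfold evalLin
  rw [Finset.sum_eq_single l]
  · simp [coeff_x hl]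
  · intro j hj hne
    simp [coeff_x (Finset.mem_range.1 hj), hne]
  · intro h; exact absurd (Finset.mem_range.2 hl) h

variable (m p d : TruncDual K n ⊗[K] TruncDual K n →ₗc[K] TruncDual K n)

theorem sum_evalLin_leftArg (l : ℕ) (s t : R) :
    ∑ i ∈ Finset.range n, s ^ i * evalLin (leftArg m.toLinearMap (x K n i)) l t =
      evalPow m l s t := by
  unfold evalLin evalPow
  refine Finset.sum_congr rfl fun i _ => ?_
  rw [Finset.mul_sum]
  refine Finset.sum_congr rfl fun j _ => ?_
  rw [show coeff l (leftArg m.toLinearMap (x K n i) (x K n j)) = structCoeff m i j l from rfl]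
  ring

/-- Because Δ splits x_j over the antidiagonal, the generating series in t turns the Sweedler sum
into a product: both arguments are evaluated at the same point t. -/
theorem sum_coeff_sweedler (φ ψ : TruncDual K n →ₗ[K] TruncDual K n) (l : ℕ) {t : R}
    (ht : t ^ n = 0) :
    ∑ j ∈ Finset.range n,
        algebraMap K R (coeff l (sweedler m.toLinearMap φ ψ (x K n j))) * t ^ j =
      ∑ k ∈ Finset.range n, ∑ k' ∈ Finset.range n,
        algebraMap K R (structCoeff m k k' l) * evalLin φ k t * evalLin ψ k' t := by
  have h : ∀ j ∈ Finset.range n,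
      algebraMap K R (coeff l (sweedler m.toLinearMap φ ψ (x K n j))) * t ^ j =
      ∑ k ∈ Finset.range n, ∑ k' ∈ Finset.range n, algebraMap K R (structCoeff m k k' l) *
        ((∑ a ∈ Finset.HasAntidiagonal.antidiagonal j, algebraMap K R (coeff k (φ (x K n a.1))) *
          algebraMap K R (coeff k' (ψ (x K n a.2)))) * t ^ j) := by
    intro j hj
    have e : coeff l (sweedler m.toLinearMap φ ψ (x K n j)) =
        ∑ a ∈ Finset.HasAntidiagonal.antidiagonal j,
          coeff l (m (φ (x K n a.1) ⊗ₜ ψ (x K n a.2))) := by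
      unfold sweedler
      rw [comul_x (Finset.mem_range.1 hj)]
      simp only [map_sum, TensorProduct.map_tmul, ← coeffLin_apply]
      rfl
    rw [e, map_sum, Finset.sum_mul]
    simp only [coeff_apply_tmul, map_sum, map_mul, Finset.sum_mul, Finset.mul_sum]
    rw [Finset.sum_comm]
    refine Finset.sum_congr rfl fun k _ => ?_
    rw [Finset.sum_comm]
    refine Finset.sum_congr rfl fun k' _ => ?_
    exact Finset.sum_congr rfl fun a _ => by ring
  rw [Finset.sum_congr rfl h, Finset.sum_comm]
  refine Finset.sum_congr rfl fun k _ => ?_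
  rw [Finset.sum_comm]
  refine Finset.sum_congr rfl fun k' _ => ?_
  rw [← Finset.mul_sum, mul_assoc, evalLin, evalLin, sum_range_mul_sum_range_of_pow_eq_zero ht]

/-- `TruncDual` is cocommutative, so the order of the Sweedler factors is immaterial. -/
theorem sweedlerOp_eq_sweedler (φ ψ : TruncDual K n →ₗ[K] TruncDual K n) (c : TruncDual K n) :
    sweedlerOp m.toLinearMap φ ψ c = sweedler m.toLinearMap φ ψ c := by
  suffices h : (TensorProduct.comm K _ _).toLinearMap ∘ₗ
      (Coalgebra.comul (R := K) (A := TruncDual K n)) = Coalgebra.comul (R := K) by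
    unfold sweedlerOp sweedler
    exact congrArg (fun t => m.toLinearMap (TensorProduct.map φ ψ t)) (LinearMap.congr_fun h c)
  refine linearMap_ext fun i hi => ?_
  simp only [LinearMap.comp_apply, comul_x hi, map_sum, LinearEquiv.coe_coe,
    TensorProduct.comm_tmul]
  exact Finset.Nat.sum_antidiagonal_swap (f := fun a => x K n a.1 ⊗ₜ[K] x K n a.2)

theorem sum_sum_comm_sum_sum {M : Type*} [AddCommMonoid M] (s : Finset ℕ)
    (F : ℕ → ℕ → ℕ → ℕ → M) :
    ∑ i ∈ s, ∑ j ∈ s, ∑ k ∈ s, ∑ l ∈ s, F i j k l =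
      ∑ k ∈ s, ∑ l ∈ s, ∑ i ∈ s, ∑ j ∈ s, F i j k l := by
  have h : ∀ i ∈ s, ∑ j ∈ s, ∑ k ∈ s, ∑ l ∈ s, F i j k l =
      ∑ k ∈ s, ∑ l ∈ s, ∑ j ∈ s, F i j k l := by
    intro i _
    rw [Finset.sum_comm]
    exact Finset.sum_congr rfl fun k _ => Finset.sum_comm
  rw [Finset.sum_congr rfl h, Finset.sum_comm]
  exact Finset.sum_congr rfl fun k _ => Finset.sum_comm

/-- `∑ a^i b^j c^k` times the first coordinate of a Sweedler expression in `x_i, x_j, x_k`. -/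
theorem sum_coeff_sweedler_leftArg (hn : 0 < n) {a b c : R} (ha : a ^ n = 0) (hb : b ^ n = 0)
    (hc : c ^ n = 0) :
    ∑ i ∈ Finset.range n, ∑ k ∈ Finset.range n, ∑ j ∈ Finset.range n,
        a ^ i * c ^ k * (algebraMap K R (coeff 1 (sweedler m.toLinearMap
          (leftArg p.toLinearMap (x K n i)) (leftArg d.toLinearMap (x K n k)) (x K n j))) * b ^ j) =
      evalPt m (evalPt p a b) (evalPt d c b) := by
  simp only [← Finset.mul_sum, sum_coeff_sweedler m _ _ 1 hb]
  have : ∀ k k', (∑ i ∈ Finset.range n, ∑ l ∈ Finset.range n, a ^ i * c ^ l *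
      (algebraMap K R (structCoeff m k k' 1) * evalLin (leftArg p.toLinearMap (x K n i)) k b *
        evalLin (leftArg d.toLinearMap (x K n l)) k' b)) =
      algebraMap K R (structCoeff m k k' 1) * evalPt p a b ^ k * evalPt d c b ^ k' := by
    intro k k'
    rw [← evalPow_eq_pow p hn ha hb, ← evalPow_eq_pow d hn hc hb, ← sum_evalLin_leftArg,
      ← sum_evalLin_leftArg, mul_assoc, Finset.sum_mul_sum, Finset.mul_sum]
    refine Finset.sum_congr rfl fun i _ => ?_
    rw [Finset.mul_sum]
    exact Finset.sum_congr rfl fun l _ => by ring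
  conv_rhs => rw [evalPt, evalPow]
  simp only [← this, Finset.mul_sum]
  exact sum_sum_comm_sum_sum _ _

variable {p d}

theorem evalPt_cycle₁ (hn : 0 < n) (h : IsRegularQCycleCoalgebra p d) {a b c : R}
    (ha : a ^ n = 0) (hb : b ^ n = 0) (hc : c ^ n = 0) :
    evalPt p (evalPt p a b) (evalPt d c b) = evalPt p (evalPt p a c) (evalPt p b c) := by
  rw [← sum_coeff_sweedler_leftArg p p d hn ha hb hc, ← sum_coeff_sweedler_leftArg p p p hn ha hc
    hb]
  simp only [h.cycle₁, sweedlerOp_eq_sweedler]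
  refine Finset.sum_congr rfl fun i _ => ?_
  rw [Finset.sum_comm]
  exact Finset.sum_congr rfl fun j _ => Finset.sum_congr rfl fun k _ => by ring

theorem evalPt_cycle₂ (hn : 0 < n) (h : IsRegularQCycleCoalgebra p d) {a b c : R}
    (ha : a ^ n = 0) (hb : b ^ n = 0) (hc : c ^ n = 0) :
    evalPt d (evalPt p a b) (evalPt p c b) = evalPt p (evalPt d a c) (evalPt d b c) := by
  rw [← sum_coeff_sweedler_leftArg d p p hn ha hb hc, ← sum_coeff_sweedler_leftArg p d d hn ha hc
    hb]
  simp only [h.cycle₂, sweedlerOp_eq_sweedler]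
  refine Finset.sum_congr rfl fun i _ => ?_
  rw [Finset.sum_comm]
  exact Finset.sum_congr rfl fun j _ => Finset.sum_congr rfl fun k _ => by ring

/-- In the generating series of ε(b) a, the counit leaves only j = 0 and the first coordinate only i
= 1, so the right side is the point a itself. The bound on n ensures that x₁ exists. -/
theorem evalPt_sweedler_id (hn : 2 ≤ n) {r : TruncDual K n ⊗[K] TruncDual K n →ₗc[K] TruncDual K n}
    (h : ∀ a b : TruncDual K n, sweedler p.toLinearMap (leftArg r.toLinearMap a) LinearMap.id b =
      Coalgebra.counit (R := K) b • a) {a b : R} (ha : a ^ n = 0) (hb : b ^ n = 0) :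
    evalPt p (evalPt r a b) b = a := by
  have h1 : ∀ i, (∑ j ∈ Finset.range n, algebraMap K R (coeff 1 (sweedler p.toLinearMap
      (leftArg r.toLinearMap (x K n i)) LinearMap.id (x K n j))) * b ^ j) =
      if i = 1 then 1 else 0 := by
    intro i
    rw [Finset.sum_eq_single 0]
    · rw [h, counit_x (by omega)]
      by_cases hi : i < n
      · simp [coeff_x hi]
      · rw [x_of_le (by omega), if_neg (by omega : i ≠ 1), smul_zero, ← coeffLin_apply]; simp
    · intro j hj hj0
      rw [h, counit_x (Finset.mem_range.1 hj), if_neg hj0, zero_smul, ← coeffLin_apply]; simp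
    · intro h; exact absurd (Finset.mem_range.2 (by omega)) h
  have h2 : ∑ i ∈ Finset.range n, a ^ i * (∑ j ∈ Finset.range n, algebraMap K R (coeff 1
      (sweedler p.toLinearMap (leftArg r.toLinearMap (x K n i)) LinearMap.id (x K n j))) * b ^ j) =
      a := by
    simp only [h1]
    rw [Finset.sum_eq_single 1]
    · simp
    · intro i _ hi; simp [hi]
    · intro h; exact absurd (Finset.mem_range.2 (by omega)) h
  refine Eq.trans ?_ h2
  simp only [sum_coeff_sweedler p _ _ 1 hb]
  simp only [Finset.mul_sum]
  rw [Finset.sum_comm]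
  conv_lhs => rw [evalPt, evalPow]
  refine Finset.sum_congr rfl fun k hk => ?_
  rw [Finset.sum_comm]
  refine Finset.sum_congr rfl fun k' hk' => ?_
  rw [← evalPow_eq_pow r (by omega) ha hb, ← sum_evalLin_leftArg, Finset.mul_sum, Finset.sum_mul]
  refine Finset.sum_congr rfl fun i _ => ?_
  rw [evalLin_id (Finset.mem_range.1 hk')]
  ring

end TruncDual

/-! ### First-order calculus on points through dual numbers. -/

namespace TruncDual

variable {K : Type*} [Field K] {n : ℕ} {R : Type*} [CommRing R] [Algebra K R]
variable (m : TruncDual K n ⊗[K] TruncDual K n →ₗc[K] TruncDual K n)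

theorem map_evalPt {R' : Type*} [CommRing R'] [Algebra K R'] (φ : R →ₐ[K] R') (s t : R) :
    φ (evalPt m s t) = evalPt m (φ s) (φ t) := by
  simp [evalPt, evalPow, map_sum]

/-- The value at `(s, t)` of `∂m/∂x`. -/
noncomputable def evalX (s t : R) : R :=
  ∑ i ∈ Finset.range n, ∑ j ∈ Finset.range n,
    algebraMap K R (structCoeff m i j 1) * (i * s ^ (i - 1)) * t ^ j

/-- The value at `(s, t)` of `∂m/∂y`. -/
noncomputable def evalY (s t : R) : R :=
  ∑ i ∈ Finset.range n, ∑ j ∈ Finset.range n,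
    algebraMap K R (structCoeff m i j 1) * s ^ i * (j * t ^ (j - 1))

theorem fst_evalPt (z w : DualNumber R) :
    (evalPt m z w).fst = evalPt m z.fst w.fst :=
  map_evalPt m (TrivSqZeroExt.fstHom K R R) z w

/-- The chain rule: as ε² = 0, only the first-order Taylor terms survive. -/
theorem snd_evalPt (z w : DualNumber R) :
    (evalPt m z w).snd = z.snd * evalX m z.fst w.fst + w.snd * evalY m z.fst w.fst := by
  unfold evalPt evalPow evalX evalY
  simp only [TrivSqZeroExt.snd_sum, Finset.mul_sum, ← Finset.sum_add_distrib]
  refine Finset.sum_congr rfl fun i _ => Finset.sum_congr rfl fun j _ => ?_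
  simp only [TrivSqZeroExt.snd_mul, TrivSqZeroExt.algebraMap_eq_inl', TrivSqZeroExt.fst_mul,
    TrivSqZeroExt.fst_inl, TrivSqZeroExt.snd_inl, TrivSqZeroExt.snd_pow, TrivSqZeroExt.fst_pow,
    smul_eq_mul, nsmul_eq_mul, MulOpposite.smul_eq_mul_unop,
    MulOpposite.unop_op, Nat.pred_eq_sub_one]
  ring

theorem dualNumber_pow_eq_zero (hn : 2 ≤ n) {z : DualNumber R} (hz : z.fst = 0) : z ^ n = 0 := by
  refine pow_eq_zero_of_le hn ?_
  ext <;> simp [pow_two, hz]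

theorem inl_pow_eq_zero {t : R} (ht : t ^ n = 0) : (TrivSqZeroExt.inl t : DualNumber R) ^ n = 0 :=
      by
  have := (map_pow (TrivSqZeroExt.inlHom R R) t n).symm
  rwa [ht, map_zero] at this

theorem evalPt_zero_left (h0 : ∀ j < n, structCoeff m 0 j 1 = 0) (t : R) : evalPt m 0 t = 0 := by
  unfold evalPt evalPow
  refine Finset.sum_eq_zero fun i _ => Finset.sum_eq_zero fun j hj => ?_
  rcases Nat.eq_zero_or_pos i with rfl | hi
  · simp [h0 j (Finset.mem_range.1 hj)]
  · simp [hi.ne']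

theorem evalX_zero_left (hn : 2 ≤ n) (t : R) :
    evalX m 0 t = ∑ j ∈ Finset.range n, algebraMap K R (structCoeff m 1 j 1) * t ^ j := by
  unfold evalX
  rw [Finset.sum_eq_single 1]
  · simp
  · intro i _ hi
    refine Finset.sum_eq_zero fun j _ => ?_
    rcases Nat.eq_zero_or_pos i with rfl | hi0
    · simp
    · simp [show i - 1 ≠ 0 by omega]
  · intro h; exact absurd (Finset.mem_range.2 (by omega)) h

theorem evalY_zero_right (hn : 2 ≤ n) (s : R) :
    evalY m s 0 = ∑ i ∈ Finset.range n, algebraMap K R (structCoeff m i 1 1) * s ^ i := by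
  unfold evalY
  refine Finset.sum_congr rfl fun i _ => ?_
  rw [Finset.sum_eq_single 1]
  · simp
  · intro j _ hj
    rcases Nat.eq_zero_or_pos j with rfl | hj0
    · simp
    · simp [show j - 1 ≠ 0 by omega]
  · intro h; exact absurd (Finset.mem_range.2 (by omega)) h

theorem evalX_zero_zero (hn : 2 ≤ n) :
    evalX m (0 : R) 0 = algebraMap K R (structCoeff m 1 0 1) := by
  rw [evalX_zero_left m hn, Finset.sum_eq_single 0]
  · simp
  · intro j _ hj; simp [hj]
  · intro h; exact absurd (Finset.mem_range.2 (by omega)) h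

/-- The constant term is the value at (0, 0) in K, and a nilpotent element of a field is zero. -/
theorem structCoeff_zero_zero_one (hn : 2 ≤ n) : structCoeff m 0 0 1 = 0 := by
  have h := evalPt_pow_eq_zero m (R := K) (s := 0) (t := 0) (by omega) (zero_pow (by omega))
    (zero_pow (by omega))
  have h' := eq_zero_of_pow_eq_zero h
  rw [evalPt, evalPow, Finset.sum_eq_single 0, Finset.sum_eq_single 0] at h'
  · simpa using h'
  · intro j _ hj; simp [hj]
  · intro h; exact absurd (Finset.mem_range.2 (by omega)) h
  · intro i _ hi; simp [hi]
  · intro h; exact absurd (Finset.mem_range.2 (by omega)) h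

theorem evalPt_zero_zero (hn : 2 ≤ n) : evalPt m (0 : R) 0 = 0 := by
  unfold evalPt evalPow
  refine Finset.sum_eq_zero fun i _ => Finset.sum_eq_zero fun j hj => ?_
  rcases Nat.eq_zero_or_pos i with rfl | hi
  · rcases Nat.eq_zero_or_pos j with rfl | hj
    · simp [structCoeff_zero_zero_one m hn]
    · simp [hj.ne']
  · simp [hi.ne']

variable {m}

/-- Differentiating m(r(a,b),b) = a at the origin in the direction of a exhibits the inverse of
m_{10}^1. -/
theorem structCoeff_one_zero_ne_zero (hn : 2 ≤ n)
    {r : TruncDual K n ⊗[K] TruncDual K n →ₗc[K] TruncDual K n}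
    (h : ∀ a b : TruncDual K n, sweedler m.toLinearMap (leftArg r.toLinearMap a) LinearMap.id b =
      Coalgebra.counit (R := K) b • a) : structCoeff m 1 0 1 ≠ 0 := by
  have e := evalPt_sweedler_id hn h (a := (DualNumber.eps : DualNumber K)) (b := 0)
    (dualNumber_pow_eq_zero hn (by simp)) (zero_pow (by omega))
  have e' := congrArg TrivSqZeroExt.snd e
  rw [snd_evalPt, fst_evalPt] at e'
  simp only [DualNumber.fst_eps, TrivSqZeroExt.fst_zero, TrivSqZeroExt.snd_zero, zero_mul, add_zero,
    evalPt_zero_zero r hn, evalX_zero_zero m hn, DualNumber.snd_eps] at e'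
  intro h0
  simp [h0] at e'

/-- Polynomials with nonzero linear term are injective on nilpotent elements. -/
theorem eq_of_sum_pow_eq (hn : 2 ≤ n) {F : ℕ → K} (hF : F 1 ≠ 0) {s t : R} (hs : s ^ n = 0)
    (ht : t ^ n = 0)
    (h : ∑ j ∈ Finset.range n, algebraMap K R (F j) * s ^ j =
      ∑ j ∈ Finset.range n, algebraMap K R (F j) * t ^ j) : s = t := by
  have key : (∑ j ∈ Finset.range n, algebraMap K R (F j) *
      ∑ k ∈ Finset.range j, s ^ k * t ^ (j - 1 - k)) * (s - t) = 0 := by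
    rw [Finset.sum_mul, ← sub_eq_zero.2 h, ← Finset.sum_sub_distrib]
    -- F(s) - F(t) is a divided difference times s - t. In that difference j = 1 contributes the
    -- unit F 1, and every other term is nilpotent.
    refine Finset.sum_congr rfl fun j _ => ?_
    rw [mul_assoc, (Commute.all s t).geom_sum₂_mul, mul_sub]
  have hu : IsUnit (∑ j ∈ Finset.range n, algebraMap K R (F j) *
      ∑ k ∈ Finset.range j, s ^ k * t ^ (j - 1 - k)) := by
    rw [← Finset.add_sum_erase _ _ (Finset.mem_range.2 (by omega : 1 < n))]
    refine IsNilpotent.isUnit_add_left_of_commute ?_ ?_ (Commute.all _ _)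
    · refine isNilpotent_sum fun j hj => ?_
      refine (Commute.all _ _).isNilpotent_mul_left ?_
      refine isNilpotent_sum fun k hk => ?_
      have hk' := Finset.mem_range.1 hk
      have hj1 := (Finset.mem_erase.1 hj).1
      rcases Nat.eq_zero_or_pos k with rfl | hk0
      · refine (Commute.all _ _).isNilpotent_mul_left ?_
        exact IsNilpotent.pow_of_pos ⟨n, ht⟩ (by omega)
      · refine (Commute.all _ _).isNilpotent_mul_right ?_
        exact IsNilpotent.pow_of_pos ⟨n, hs⟩ (by omega)
    · simpa using (IsUnit.mk0 _ hF).map (algebraMap K R)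
  exact sub_eq_zero.1 ((hu.mul_right_eq_zero).1 key)

end TruncDual

/-! ### Truncation in K[[x]][[y]] and the generic point (x, y). -/

namespace PowerSeries

variable (K : Type*) [Field K]

/-- The series in `K[[x]][[y]]` all of whose coefficients at `xⁱ yʲ`, `i, j < n`, vanish. -/
def truncIdeal (n : ℕ) : Ideal K⟦X⟧⟦X⟧ where
  carrier := {H | ∀ i < n, ∀ j < n, coeff i (coeff j H) = 0}
  add_mem' {a b} ha hb i hi j hj := by simp [ha i hi j hj, hb i hi j hj]
  zero_mem' i _ j _ := by simp
  smul_mem' c H hH i hi j hj := by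
    rw [smul_eq_mul, coeff_mul, map_sum]
    refine Finset.sum_eq_zero fun a ha => ?_
    rw [coeff_mul]
    refine Finset.sum_eq_zero fun b hb => ?_
    have := Finset.HasAntidiagonal.mem_antidiagonal.1 ha
    have := Finset.HasAntidiagonal.mem_antidiagonal.1 hb
    rw [hH _ (by omega) _ (by omega), mul_zero]

variable {K}

theorem X_pow_mem_truncIdeal (n : ℕ) : (X : K⟦X⟧⟦X⟧) ^ n ∈ truncIdeal K n := by
  intro i hi j hj
  rw [coeff_X_pow, if_neg (by omega), map_zero]

theorem C_X_pow_mem_truncIdeal (n : ℕ) : (C (X : K⟦X⟧) : K⟦X⟧⟦X⟧) ^ n ∈ truncIdeal K n := by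
  intro i hi j hj
  rw [← map_pow, coeff_C]
  split_ifs
  · rw [coeff_X_pow, if_neg (by omega)]
  · rw [map_zero]

end PowerSeries

namespace TruncDual

open PowerSeries

variable {K : Type*} [Field K] {n : ℕ}
variable (m p d : TruncDual K n ⊗[K] TruncDual K n →ₗc[K] TruncDual K n)

/-- The series `∑ m_{ij}^1 x^i y^j`. -/
noncomputable def series : K⟦X⟧⟦X⟧ :=
  PowerSeries.mk fun j => PowerSeries.mk fun i => structCoeff m i j 1

@[simp]
theorem coeff_coeff_series (i j : ℕ) : PowerSeries.coeff i (PowerSeries.coeff j (series m)) =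
      structCoeff m i j 1 := by
  simp [series]

theorem algebraMap_powerSeries (c : K) : algebraMap K K⟦X⟧⟦X⟧ c = C (C c) := by
  simp [PowerSeries.algebraMap_apply]

theorem sum_C_C_mul_eq_mk {F : ℕ → ℕ → K} (h : ∀ i j, n ≤ i ∨ n ≤ j → F i j = 0) :
    ∑ i ∈ Finset.range n, ∑ j ∈ Finset.range n,
      algebraMap K K⟦X⟧⟦X⟧ (F i j) * C (X : K⟦X⟧) ^ i * X ^ j =
      PowerSeries.mk fun j => PowerSeries.mk fun i => F i j := by
  ext j i
  simp only [algebraMap_powerSeries, map_sum, coeff_mk, ← map_pow, ← map_mul, coeff_C_mul,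
    coeff_X_pow]
  simp only [mul_ite, mul_one, mul_zero, apply_ite (PowerSeries.coeff i), map_zero,
    Finset.sum_ite_eq,
    coeff_C_mul, coeff_X_pow]
  by_cases hj : j < n
  · by_cases hi : i < n
    · simp [hi, hj]
    · simp [hi, h i j (by omega)]
  · simp [hj, h i j (by omega)]

/-- The series of `m` is its value at the generic pair (x, y). These elements are not nilpotent in
K[[x]][[y]], so identities between points are applied to their classes modulo `truncIdeal`. -/
theorem evalPt_series : evalPt m (C (X : K⟦X⟧) : K⟦X⟧⟦X⟧) X = series m := by
  refine sum_C_C_mul_eq_mk fun i j h => ?_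
  rcases h with h | h
  · exact structCoeff_of_le_left m h j 1
  · exact structCoeff_of_le_right m i h 1

theorem evalX_series : evalX m (C (X : K⟦X⟧) : K⟦X⟧⟦X⟧) X = Standard.derivX (series m) := by
  ext j i
  unfold evalX
  simp only [Standard.derivX, algebraMap_powerSeries, map_sum, coeff_mk, ← map_pow, ← map_mul,
    coeff_derivative, coeff_coeff_series, ← map_natCast (C : K⟦X⟧ →+* K⟦X⟧⟦X⟧),
    ← map_natCast (C : K →+* K⟦X⟧), coeff_C_mul, coeff_X_pow]
  simp only [mul_ite, mul_one, mul_zero, apply_ite (PowerSeries.coeff i), map_zero,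
    Finset.sum_ite_eq,
    coeff_C_mul, coeff_X_pow]
  by_cases hj : j < n
  · simp only [Finset.mem_range, hj, if_true]
    by_cases hi : i + 1 < n
    · rw [Finset.sum_eq_single (i + 1)]
      · simp
      · intro k _ hk
        rcases Nat.eq_zero_or_pos k with rfl | hk0
        · simp
        · rw [if_neg (by omega)]
      · intro h; exact absurd (Finset.mem_range.2 hi) h
    · rw [structCoeff_of_le_left m (by omega), zero_mul]
      refine Finset.sum_eq_zero fun k hk => ?_
      have := Finset.mem_range.1 hk
      rcases Nat.eq_zero_or_pos k with rfl | hk0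
      · simp
      · rw [if_neg (by omega)]
  · simp [hj, structCoeff_of_le_right m (i + 1) (not_lt.1 hj)]

theorem evalY_series : evalY m (C (X : K⟦X⟧) : K⟦X⟧⟦X⟧) X = derivative K⟦X⟧ (series m) := by
  ext j i
  unfold evalY
  have hc : PowerSeries.coeff i (PowerSeries.coeff j (derivative K⟦X⟧ (series m))) = structCoeff m
    i (j + 1) 1 * (j + 1) := by
    rw [coeff_derivative]
    have : ((j : K⟦X⟧) + 1) = C ((j : K) + 1) := by simp
    rw [this, coeff_mul_C, coeff_coeff_series]
  rw [hc]
  simp only [algebraMap_powerSeries, map_sum, ← map_pow, ← map_mul,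
    ← map_natCast (C : K⟦X⟧ →+* K⟦X⟧⟦X⟧),
    ← map_natCast (C : K →+* K⟦X⟧), ← mul_assoc, coeff_C_mul, coeff_X_pow]
  simp only [mul_ite, mul_one, mul_zero, apply_ite (PowerSeries.coeff i), map_zero,
    coeff_C_mul, coeff_mul_C, coeff_X_pow]
  by_cases hi : i < n
  · by_cases hj : j + 1 < n
    · rw [Finset.sum_eq_single i, Finset.sum_eq_single (j + 1)]
      · simp
      · intro k _ hk
        rcases Nat.eq_zero_or_pos k with rfl | hk0
        · simp
        · rw [if_neg (by omega)]
      · intro h; exact absurd (Finset.mem_range.2 hj) h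
      · intro k _ hk
        refine Finset.sum_eq_zero fun l _ => ?_
        simp [Ne.symm hk]
      · intro h; exact absurd (Finset.mem_range.2 hi) h
    · rw [structCoeff_of_le_right m _ (by omega), zero_mul]
      refine Finset.sum_eq_zero fun k _ => Finset.sum_eq_zero fun l hl => ?_
      have := Finset.mem_range.1 hl
      rcases Nat.eq_zero_or_pos l with rfl | hl0
      · simp
      · rw [if_neg (by omega)]
  · rw [structCoeff_of_le_left m (by omega), zero_mul]
    refine Finset.sum_eq_zero fun k hk => Finset.sum_eq_zero fun l _ => ?_
    have := Finset.mem_range.1 hk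
    simp [show i ≠ k by omega]

theorem series_pow_mem_truncIdeal (hn : 0 < n) : series m ^ n ∈ truncIdeal K n := by
  rw [← Ideal.Quotient.eq_zero_iff_mem, map_pow, ← evalPt_series]
  have h := map_evalPt m (Ideal.Quotient.mkₐ K (truncIdeal K n)) (C (X : K⟦X⟧)) X
  rw [Ideal.Quotient.mkₐ_eq_mk] at h
  rw [h]
  refine evalPt_pow_eq_zero m hn ?_ ?_
  · rw [← map_pow, Ideal.Quotient.eq_zero_iff_mem]; exact C_X_pow_mem_truncIdeal n
  · rw [← map_pow, Ideal.Quotient.eq_zero_iff_mem]; exact X_pow_mem_truncIdeal n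

/-- In characteristic zero, `m` vanishes on `x₀ ⊗ C`, up to the counit. -/
theorem structCoeff_zero_left [CharZero K] (hn : 2 ≤ n) (h10 : structCoeff m 1 0 1 ≠ 0) (j : ℕ)
    (hj : j < n) : structCoeff m 0 j 1 = 0 := by
  induction j using Nat.strong_induction_on with
  | _ j ih =>
  rcases Nat.eq_zero_or_pos j with rfl | hj0
  · exact structCoeff_zero_zero_one m hn
  set U : K⟦X⟧⟦X⟧ :=
    PowerSeries.mk fun j => PowerSeries.mk fun i => structCoeff m (i + 1) j 1 with hU
  set W : K⟦X⟧⟦X⟧ := PowerSeries.mk fun k => C (structCoeff m 0 (k + j) 1) with hW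
  -- By induction the terms free of x start at y^j.
  have hs : series m = C (X : K⟦X⟧) * U + X ^ j * W := by
    ext k i
    rw [coeff_coeff_series, map_add, coeff_C_mul, coeff_X_pow_mul', map_add]
    simp only [hU, hW, coeff_mk]
    rcases i with _ | i
    · split_ifs with hk
      · simp [Nat.sub_add_cancel hk]
      · simp [ih k (not_le.1 hk) (by omega)]
    · rw [coeff_succ_X_mul, coeff_mk]
      split_ifs
      · simp
      · simp
  -- Expand (xU + y^j W)^n at x^{n-1} y^j. The first term is divisible by x^n and the remainder by
  -- y^{2j}, hence by y^{j+1} since j ≥ 1. Only the middle term contributes, namely n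
  -- (m_{10}^1)^{n-1} m_{0j}^1.
  obtain ⟨k, hk⟩ := Polynomial.powAddExpansion (C (X : K⟦X⟧) * U) (X ^ j * W) n
  have h := series_pow_mem_truncIdeal m (by omega : 0 < n) (n - 1) (by omega) j hj
  have e1 : (C (X : K⟦X⟧) * U) ^ n = C (X ^ n) * U ^ n := by rw [mul_pow, map_pow]
  have e2 : (n : K⟦X⟧⟦X⟧) * (C (X : K⟦X⟧) * U) ^ (n - 1) * (X ^ j * W) =
      C (X ^ (n - 1)) * (X ^ j * (C (C (n : K)) * U ^ (n - 1) * W)) := by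
    rw [mul_pow, map_pow]; simp only [map_natCast]; ring
  have e3 : k * (X ^ j * W) ^ 2 = X ^ (j + 1) * (X ^ (j - 1) * (k * W ^ 2)) := by
    rw [mul_pow, ← mul_assoc (X ^ (j + 1)), ← pow_add, ← pow_mul,
      show j + 1 + (j - 1) = j * 2 by omega]; ring
  simp only [hs, hk, e1, e2, e3, map_add, coeff_C_mul] at h
  rw [coeff_X_pow_mul', if_neg (by omega), coeff_X_pow_mul' _ j, if_pos le_rfl,
    coeff_X_pow_mul', if_pos le_rfl, coeff_X_pow_mul', if_neg (by omega), map_zero, zero_add,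
    add_zero, Nat.sub_self, Nat.sub_self] at h
  have h' : (n : K) * structCoeff m 1 0 1 ^ (n - 1) * structCoeff m 0 j 1 = 0 := by
    have hU0 : constantCoeff (constantCoeff U) = structCoeff m 1 0 1 := by
      rw [← coeff_zero_eq_constantCoeff_apply, ← coeff_zero_eq_constantCoeff_apply]; simp [hU]
    have hW0 : constantCoeff (constantCoeff W) = structCoeff m 0 j 1 := by
      rw [← coeff_zero_eq_constantCoeff_apply, ← coeff_zero_eq_constantCoeff_apply]; simp [hW]
    rw [coeff_zero_eq_constantCoeff_apply, coeff_zero_eq_constantCoeff_apply] at h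
    simp only [map_mul, map_pow, hU0, hW0] at h
    simpa using h
  have hn0 : (n : K) ≠ 0 := Nat.cast_ne_zero.2 (by omega)
  exact (mul_eq_zero.1 h').resolve_left (mul_ne_zero hn0 (pow_ne_zero _ h10))

end TruncDual

/-! ### Infinitesimal consequences of the cycle identities. -/

namespace TruncDual

open PowerSeries

variable {K : Type*} [Field K] {n : ℕ} {R : Type*} [CommRing R] [Algebra K R]
variable {p d : TruncDual K n ⊗[K] TruncDual K n →ₗc[K] TruncDual K n}

theorem _root_.IsRegularQCycleCoalgebra.structCoeff_one_zero_fst (hn : 2 ≤ n)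
    (h : IsRegularQCycleCoalgebra p d) : structCoeff p 1 0 1 ≠ 0 := by
  obtain ⟨⟨r, hr⟩, -⟩ := h.regular
  exact structCoeff_one_zero_ne_zero hn fun a b => (hr a b).1

theorem _root_.IsRegularQCycleCoalgebra.structCoeff_one_zero_snd (hn : 2 ≤ n)
    (h : IsRegularQCycleCoalgebra p d) : structCoeff d 1 0 1 ≠ 0 := by
  obtain ⟨-, ⟨r, hr⟩⟩ := h.regular
  refine structCoeff_one_zero_ne_zero (r := r) hn fun a b => ?_
  rw [← sweedlerOp_eq_sweedler]
  exact (hr a b).2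

variable [CharZero K]

theorem _root_.IsRegularQCycleCoalgebra.evalPt_zero_fst (hn : 2 ≤ n)
    (h : IsRegularQCycleCoalgebra p d) (t : R) : evalPt p 0 t = 0 :=
  evalPt_zero_left p (structCoeff_zero_left p hn (h.structCoeff_one_zero_fst hn)) t

theorem _root_.IsRegularQCycleCoalgebra.evalPt_zero_snd (hn : 2 ≤ n)
    (h : IsRegularQCycleCoalgebra p d) (t : R) : evalPt d 0 t = 0 :=
  evalPt_zero_left d (structCoeff_zero_left d hn (h.structCoeff_one_zero_snd hn)) t

/-- `a · 1 = a`. -/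
theorem _root_.IsRegularQCycleCoalgebra.evalPt_fst_zero (hn : 2 ≤ n)
    (h : IsRegularQCycleCoalgebra p d) (h11 : structCoeff p 1 1 1 ≠ 0) {t : R} (ht : t ^ n = 0) :
    evalPt p t 0 = t := by
  refine eq_of_sum_pow_eq hn (F := fun j => structCoeff p 1 j 1) h11
    (evalPt_pow_eq_zero p (by omega) ht (zero_pow (by omega))) ht ?_
  rw [← evalX_zero_left p hn, ← evalX_zero_left p hn]
  -- With a = ε and c = 0 the ε-parts give p_x(0,t) p_x(0,0) = p_x(0,0) p_x(0,p(t,0)). After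
  -- cancelling p_x(0,0), injectivity of p_x(0,·) on nilpotents finishes.
  have e := evalPt_cycle₁ (by omega) h (a := (DualNumber.eps : DualNumber R))
    (b := TrivSqZeroExt.inl t) (c := 0) (dualNumber_pow_eq_zero hn (by simp))
    (inl_pow_eq_zero ht) (zero_pow (by omega))
  have e' := congrArg TrivSqZeroExt.snd e
  simp only [snd_evalPt, fst_evalPt, DualNumber.fst_eps, DualNumber.snd_eps,
    TrivSqZeroExt.fst_inl, TrivSqZeroExt.snd_inl, TrivSqZeroExt.fst_zero, TrivSqZeroExt.snd_zero,
    h.evalPt_zero_fst hn, h.evalPt_zero_snd hn, zero_mul, one_mul, add_zero,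
    evalX_zero_zero p hn] at e'
  have hu := (IsUnit.mk0 _ (h.structCoeff_one_zero_fst hn)).map (algebraMap K R)
  rw [mul_comm] at e'
  exact (hu.mul_left_cancel e').symm

/-- `a : 1 = a`. -/
theorem _root_.IsRegularQCycleCoalgebra.evalPt_snd_zero (hn : 2 ≤ n)
    (h : IsRegularQCycleCoalgebra p d) (h11 : structCoeff p 1 1 1 ≠ 0) {t : R} (ht : t ^ n = 0) :
    evalPt d t 0 = t := by
  refine eq_of_sum_pow_eq hn (F := fun j => structCoeff p 1 j 1) h11
    (evalPt_pow_eq_zero d (by omega) ht (zero_pow (by omega))) ht ?_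
  rw [← evalX_zero_left p hn, ← evalX_zero_left p hn]
  -- The roles of b and c are exchanged, so that d(t,0) appears inside p_x(0,·); the comparison is
  -- still made through p.
  have e := evalPt_cycle₁ (by omega) h (a := (DualNumber.eps : DualNumber R))
    (b := 0) (c := TrivSqZeroExt.inl t) (dualNumber_pow_eq_zero hn (by simp))
    (zero_pow (by omega)) (inl_pow_eq_zero ht)
  have e' := congrArg TrivSqZeroExt.snd e
  simp only [snd_evalPt, fst_evalPt, DualNumber.fst_eps, DualNumber.snd_eps,
    TrivSqZeroExt.fst_inl, TrivSqZeroExt.snd_inl, TrivSqZeroExt.fst_zero, TrivSqZeroExt.snd_zero,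
    h.evalPt_zero_fst hn, zero_mul, one_mul, add_zero,
    evalX_zero_zero p hn] at e'
  have hu := (IsUnit.mk0 _ (h.structCoeff_one_zero_fst hn)).map (algebraMap K R)
  rw [mul_comm (evalX p 0 t)] at e'
  exact hu.mul_left_cancel e'

/-- The part of the first cycle identity linear in `c`. -/
theorem _root_.IsRegularQCycleCoalgebra.evalPt_deriv_fst (hn : 2 ≤ n)
    (h : IsRegularQCycleCoalgebra p d) (h11 : structCoeff p 1 1 1 ≠ 0) {a b : R}
    (ha : a ^ n = 0) (hb : b ^ n = 0) :
    evalX d 0 b * evalY p (evalPt p a b) 0 =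
      evalY p a 0 * evalX p a b + evalY p b 0 * evalY p a b := by
  have e := evalPt_cycle₁ (by omega) h (a := TrivSqZeroExt.inl a)
    (b := TrivSqZeroExt.inl b) (c := (DualNumber.eps : DualNumber R))
    (inl_pow_eq_zero ha) (inl_pow_eq_zero hb) (dualNumber_pow_eq_zero hn (by simp))
  have e' := congrArg TrivSqZeroExt.snd e
  simpa only [snd_evalPt, fst_evalPt, DualNumber.fst_eps, DualNumber.snd_eps,
    TrivSqZeroExt.fst_inl, TrivSqZeroExt.snd_inl, h.evalPt_zero_fst hn, h.evalPt_zero_snd hn,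
    zero_mul, one_mul, add_zero, zero_add, h.evalPt_fst_zero hn h11 ha,
    h.evalPt_fst_zero hn h11 hb] using e'

/-- The part of the second cycle identity linear in `b`. -/
theorem _root_.IsRegularQCycleCoalgebra.evalPt_deriv_snd (hn : 2 ≤ n)
    (h : IsRegularQCycleCoalgebra p d) (h11 : structCoeff p 1 1 1 ≠ 0) {a b : R}
    (ha : a ^ n = 0) (hb : b ^ n = 0) :
    evalX d 0 b * evalY p (evalPt d a b) 0 =
      evalY p a 0 * evalX d a b + evalY p b 0 * evalY d a b := by
  -- The infinitesimal variable is now the middle one; the same factors p_y(·,0) and d_x(0,·) arise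
  -- as in the equation for p.
  have e := evalPt_cycle₂ (by omega) h (a := TrivSqZeroExt.inl a)
    (c := TrivSqZeroExt.inl b) (b := (DualNumber.eps : DualNumber R))
    (inl_pow_eq_zero ha) (dualNumber_pow_eq_zero hn (by simp)) (inl_pow_eq_zero hb)
  have e' := congrArg TrivSqZeroExt.snd e
  simpa only [snd_evalPt, fst_evalPt, DualNumber.fst_eps, DualNumber.snd_eps,
    TrivSqZeroExt.fst_inl, TrivSqZeroExt.snd_inl, h.evalPt_zero_fst hn, h.evalPt_zero_snd hn,
    zero_mul, one_mul, add_zero, zero_add, h.evalPt_fst_zero hn h11 ha,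
    h.evalPt_fst_zero hn h11 hb] using e'.symm

end TruncDual

/-! ### The differential equations characterizing G. -/

namespace Standard

open PowerSeries

variable {K : Type*} [Field K]

theorem derivative_mul {R : Type*} [CommRing R] (H L : R⟦X⟧) :
    derivative R (H * L) = H * derivative R L + L * derivative R H := by
  rw [Derivation.leibniz, smul_eq_mul, smul_eq_mul]

/-- `derivX` as a derivation. -/
noncomputable def derivXDerivation (K : Type*) [Field K] :
    Derivation K K⟦X⟧⟦X⟧ K⟦X⟧⟦X⟧ :=
  Derivation.mk'
    { toFun := derivX
      map_add' := fun H L => by ext v; simp [derivX]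
      map_smul' := fun c H => by
        ext1 v
        simp [derivX] }
    (fun H L => by
      ext1 v
      simp only [LinearMap.coe_mk, AddHom.coe_mk, derivX, coeff_mk, coeff_mul, map_add, map_sum,
        Derivation.leibniz, smul_eq_mul, Finset.sum_add_distrib]
      congr 1
      exact Finset.Nat.sum_antidiagonal_swap
        (f := fun a => coeff a.1 L * derivative K (coeff a.2 H)))

theorem derivX_map_C (φ : K⟦X⟧) : derivX (PowerSeries.map C φ) = 0 := by
  ext1 v
  simp [derivX]

theorem derivative_derivX (H : K⟦X⟧⟦X⟧) :
    derivative K⟦X⟧ (derivX H) = derivX (derivative K⟦X⟧ H) := by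
  ext1 v
  have : ((v : K⟦X⟧) + 1) = C ((v : K) + 1) := by simp
  simp only [derivX, coeff_derivative, coeff_mk, this]
  rw [Derivation.leibniz, ← algebraMap_eq, Derivation.map_algebraMap]
  simp [mul_comm]

theorem derivative_C_mul (g : K⟦X⟧) (H : K⟦X⟧⟦X⟧) :
    derivative K⟦X⟧ (C g * H) = C g * derivative K⟦X⟧ H := by
  ext1 v
  simp only [coeff_derivative, coeff_C_mul, mul_assoc]

/-- The derivation `g(x) ∂/∂x`. -/
noncomputable def fieldX (g : K⟦X⟧) : Derivation K K⟦X⟧⟦X⟧ K⟦X⟧⟦X⟧ :=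
  (C g : K⟦X⟧⟦X⟧) • derivXDerivation K

/-- The derivation `g(y) ∂/∂y`. -/
noncomputable def fieldY (g : K⟦X⟧) : Derivation K K⟦X⟧⟦X⟧ K⟦X⟧⟦X⟧ :=
  (PowerSeries.map C g : K⟦X⟧⟦X⟧) • Derivation.mk'
    { toFun := fun H => derivative K⟦X⟧ H
      map_add' := fun H L => map_add _ H L
      map_smul' := fun c H => by
        ext1 v
        simp [coeff_derivative] }
    (fun H L => by
      simp only [LinearMap.coe_mk, AddHom.coe_mk, smul_eq_mul]
      exact derivative_mul H L)

theorem fieldX_apply (g : K⟦X⟧) (H : K⟦X⟧⟦X⟧) : fieldX g H = C g * derivX H := rfl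

theorem fieldY_apply (g : K⟦X⟧) (H : K⟦X⟧⟦X⟧) :
    fieldY g H = PowerSeries.map C g * derivative K⟦X⟧ H := rfl

theorem fieldX_map_C_mul (g φ : K⟦X⟧) (H : K⟦X⟧⟦X⟧) :
    fieldX g (PowerSeries.map C φ * H) = PowerSeries.map C φ * fieldX g H := by
  rw [Derivation.leibniz, fieldX_apply g (PowerSeries.map C φ), derivX_map_C]
  simp

/-- The two fields act on different variables and each has coefficients in its own variable only. -/
theorem fieldY_fieldX (g : K⟦X⟧) (H : K⟦X⟧⟦X⟧) :
    fieldY g (fieldX g H) = fieldX g (fieldY g H) := by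
  rw [fieldY_apply g H, fieldX_map_C_mul, fieldY_apply, fieldX_apply, fieldX_apply,
    derivative_C_mul, derivative_derivX]

section Coefficients

variable {g : K⟦X⟧} {H : K⟦X⟧⟦X⟧} {n : ℕ}

theorem coeff_fieldX (i j : ℕ) : coeff i (coeff j (fieldX g H)) =
    ∑ a ∈ Finset.HasAntidiagonal.antidiagonal i,
      coeff a.1 g * (coeff (a.2 + 1) (coeff j H) * (a.2 + 1)) := by
  rw [fieldX_apply, coeff_C_mul, coeff_mul]
  simp [derivX, coeff_derivative]

theorem coeff_fieldY (i j : ℕ) : coeff i (coeff j (fieldY g H)) =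
    ∑ a ∈ Finset.HasAntidiagonal.antidiagonal j,
      coeff a.1 g * (coeff i (coeff (a.2 + 1) H) * (a.2 + 1)) := by
  rw [fieldY_apply, coeff_mul, map_sum]
  refine Finset.sum_congr rfl fun a _ => ?_
  have : ((a.2 : K⟦X⟧) + 1) = C ((a.2 : K) + 1) := by simp
  rw [coeff_map, coeff_C_mul, coeff_derivative, this, coeff_mul_C]

/-- As g = x + ⋯, the field g ∂/∂x acts on a lowest term x^i as x ∂/∂x does, with eigenvalue i. -/
theorem coeff_fieldX_of_lt (hg0 : coeff 0 g = 0) (hg1 : coeff 1 g = 1) {i j : ℕ}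
    (h : ∀ i' < i, coeff i' (coeff j H) = 0) :
    coeff i (coeff j (fieldX g H)) = i * coeff i (coeff j H) := by
  rw [coeff_fieldX]
  rcases i with _ | i
  · simp [hg0]
  · rw [Finset.sum_eq_single (1, i)]
    · simp [hg1, mul_comm]
    · rintro ⟨k, l⟩ hkl hne
      have hkl' := Finset.HasAntidiagonal.mem_antidiagonal.1 hkl
      simp only at hkl' ⊢
      rcases Nat.eq_zero_or_pos k with rfl | hk
      · rw [hg0, zero_mul]
      · have hk1 : k ≠ 1 := by rintro rfl; exact hne (by simp; omega)
        rw [h (l + 1) (by omega), zero_mul, mul_zero]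
    · intro h'; exact absurd (by simp [add_comm]) h'

theorem coeff_fieldY_of_lt (hg0 : coeff 0 g = 0) (hg1 : coeff 1 g = 1) {i j : ℕ}
    (h : ∀ j' < j, coeff i (coeff j' H) = 0) :
    coeff i (coeff j (fieldY g H)) = j * coeff i (coeff j H) := by
  rw [coeff_fieldY]
  rcases j with _ | j
  · simp [hg0]
  · rw [Finset.sum_eq_single (1, j)]
    · simp [hg1, mul_comm]
    · rintro ⟨k, l⟩ hkl hne
      have hkl' := Finset.HasAntidiagonal.mem_antidiagonal.1 hkl
      simp only at hkl' ⊢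
      rcases Nat.eq_zero_or_pos k with rfl | hk
      · rw [hg0, zero_mul]
      · have hk1 : k ≠ 1 := by rintro rfl; exact hne (by simp; omega)
        rw [h (l + 1) (by omega), zero_mul, mul_zero]
    · intro h'; exact absurd (by simp [add_comm]) h'

/-- At a lowest-order term, multiplication by u sees only the constant term of u. -/
theorem coeff_coeff_mul_of_lt {u : K⟦X⟧⟦X⟧} {i j : ℕ}
    (h : ∀ i' ≤ i, ∀ j' ≤ j, i' + j' < i + j → coeff i' (coeff j' H) = 0) :
    coeff i (coeff j (u * H)) = coeff 0 (coeff 0 u) * coeff i (coeff j H) := by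
  rw [coeff_mul, map_sum, Finset.sum_eq_single (0, j)]
  · rw [coeff_mul, Finset.sum_eq_single (0, i)]
    · rintro ⟨k, l⟩ hkl hne
      have hkl' := Finset.HasAntidiagonal.mem_antidiagonal.1 hkl
      simp only at hkl' ⊢
      have : k ≠ 0 := by rintro rfl; exact hne (by simp; omega)
      rw [h l (by omega) j le_rfl (by omega), mul_zero]
    · intro h'; exact absurd (by simp) h'
  · rintro ⟨k, l⟩ hkl hne
    have hkl' := Finset.HasAntidiagonal.mem_antidiagonal.1 hkl
    simp only at hkl' ⊢
    have : k ≠ 0 := by rintro rfl; exact hne (by simp; omega)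
    rw [coeff_mul]
    refine Finset.sum_eq_zero fun a ha => ?_
    have ha' := Finset.HasAntidiagonal.mem_antidiagonal.1 ha
    rw [h a.2 (by omega) l (by omega) (by omega), mul_zero]
  · intro h'; exact absurd (by simp) h'

/-- Differentiation alone lowers the order in x; the condition g(0) = 0 restores it, so this field
descends to the truncation. -/
theorem fieldX_mem_truncIdeal (hg0 : coeff 0 g = 0) (hH : H ∈ truncIdeal K n) :
    fieldX g H ∈ truncIdeal K n := by
  intro i hi j hj
  rw [coeff_fieldX]
  refine Finset.sum_eq_zero fun a ha => ?_
  have ha' := Finset.HasAntidiagonal.mem_antidiagonal.1 ha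
  rcases Nat.eq_zero_or_pos a.1 with h0 | h0
  · rw [h0, hg0, zero_mul]
  · rw [hH _ (by omega) _ hj, zero_mul, mul_zero]

variable [CharZero K]

/-- The homogeneous components of a solution of `g(x) H_x + g(y) H_y = u H` of degree other than
`u(0, 0) = 1` vanish, if the component of degree one does. -/
theorem mem_truncIdeal_of_euler (hg0 : coeff 0 g = 0) (hg1 : coeff 1 g = 1) {u : K⟦X⟧⟦X⟧}
    (hu : coeff 0 (coeff 0 u) = 1) (h10 : coeff 1 (coeff 0 H) = 0) (h01 : coeff 0 (coeff 1 H) = 0)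
    (h : fieldX g H + fieldY g H - u * H ∈ truncIdeal K n) : H ∈ truncIdeal K n := by
  suffices hm : ∀ m i j, i + j = m → i < n → j < n → coeff i (coeff j H) = 0 from
    fun i hi j hj => hm _ i j rfl hi hj
  intro m
  induction m using Nat.strong_induction_on with
  | _ m ih =>
  intro i j hij hi hj
  have e := h i hi j hj
  rw [map_sub, map_sub, map_add, map_add,
    coeff_fieldX_of_lt hg0 hg1 (fun i' hi' => ih (i' + j) (by omega) i' j rfl (by omega) hj),
    coeff_fieldY_of_lt hg0 hg1 (fun j' hj' => ih (i + j') (by omega) i j' rfl hi (by omega)),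
    coeff_coeff_mul_of_lt (fun i' _ j' _ hlt => ih (i' + j') (by omega) i' j' rfl (by omega)
      (by omega)), hu] at e
  -- In degree m the two fields contribute i + j = m and u contributes 1.
  have e' : ((m : K) - 1) * coeff i (coeff j H) = 0 := by
    rw [← e, ← hij]; push_cast; ring
  rcases mul_eq_zero.1 e' with h1 | h1
  · have hm1 : m = 1 := by exact_mod_cast sub_eq_zero.1 h1
    rcases Nat.eq_zero_or_pos i with rfl | hi0
    · obtain rfl : j = 1 := by omega
      exact h01
    · obtain rfl : i = 1 := by omega
      obtain rfl : j = 0 := by omega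
      exact h10
  · exact h1

/-- Uniqueness for a linear evolution equation in y. Since u has no constant term, the right side at
a lowest term vanishes, while the left side multiplies it by j; the terms with j = 0 are the initial
data. -/
theorem mem_truncIdeal_of_fieldY (hg0 : coeff 0 g = 0) (hg1 : coeff 1 g = 1) {u : K⟦X⟧⟦X⟧}
    (hu : coeff 0 (coeff 0 u) = 0) (h0 : ∀ i < n, coeff i (coeff 0 H) = 0)
    (h : fieldY g H - u * fieldX g H ∈ truncIdeal K n) : H ∈ truncIdeal K n := by
  suffices hm : ∀ m i j, i + j = m → i < n → j < n → coeff i (coeff j H) = 0 from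
    fun i hi j hj => hm _ i j rfl hi hj
  intro m
  induction m using Nat.strong_induction_on with
  | _ m ih =>
  intro i j hij hi hj
  rcases Nat.eq_zero_or_pos j with rfl | hj0
  · exact h0 i hi
  have e := h i hi j hj
  have hX : ∀ i' ≤ i, ∀ j' ≤ j, i' + j' < i + j → coeff i' (coeff j' (fieldX g H)) = 0 := by
    intro i' hi' j' hj' hlt
    rw [coeff_fieldX_of_lt hg0 hg1 (fun i'' hi'' =>
      ih (i'' + j') (by omega) i'' j' rfl (by omega) (by omega)),
      ih (i' + j') (by omega) i' j' rfl (by omega) (by omega), mul_zero]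
  rw [map_sub, map_sub, coeff_coeff_mul_of_lt hX, hu, zero_mul, sub_zero,
    coeff_fieldY_of_lt hg0 hg1 (fun j' hj' => ih (i + j') (by omega) i j' rfl hi (by omega))] at e
  exact (mul_eq_zero.1 e).resolve_left (Nat.cast_ne_zero.2 hj0.ne')

end Coefficients

theorem C_mem_truncIdeal {n : ℕ} {φ : K⟦X⟧} (h : X ^ n ∣ φ) : (C φ : K⟦X⟧⟦X⟧) ∈ truncIdeal K n := by
  intro i hi j _
  rw [coeff_C]
  split_ifs
  · exact X_pow_dvd_iff.1 h i hi
  · rw [map_zero]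

theorem map_C_mem_truncIdeal {n : ℕ} {φ : K⟦X⟧} (h : X ^ n ∣ φ) :
    (PowerSeries.map C φ : K⟦X⟧⟦X⟧) ∈ truncIdeal K n := by
  intro i _ j hj
  rw [coeff_map, X_pow_dvd_iff.1 h j hj, map_zero, map_zero]

variable [CharZero K] {n : ℕ} {f : K⟦X⟧}

/-- `g(y) G_y = (f(y) - 1) g(x) G_x`. -/
theorem fieldY_G (hf : IsParameter n 1 f) :
    fieldY (g 1 f) (G 1 f) = PowerSeries.map C (f - 1) * fieldX (g 1 f) (G 1 f) := by
  have h := (G_spec hf).2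
  have hg := congrArg (PowerSeries.map (C : K →+* K⟦X⟧)) (g_mul_derivative hf)
  have hf0 : (PowerSeries.map (C : K →+* K⟦X⟧) f) ≠ 0 := by
    intro h0
    have := congrArg (fun H => coeff 0 (coeff 0 H)) h0
    simp only [coeff_map, hf.coeff_zero, map_zero, map_one] at this
    simp at this
  -- The defining equation says f(y) G_y = f'(y) g(x) G_x. Multiplying by g(y) and using gf' =
  -- f(f-1) produces an extra factor f(y), cancelled here.
  apply mul_left_cancel₀ hf0
  rw [fieldX_apply, fieldY_apply]
  simp only [map_mul, map_sub, map_one, pow_one] at h hg ⊢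
  linear_combination (PowerSeries.map C (g 1 f)) * h + C (g 1 f) * derivX (G 1 f) * hg

/-- A series `P = x + ⋯` with `f(y) g(P) = g(x) P_x + g(y) P_y` agrees with `G`. -/
theorem sub_G_mem_truncIdeal (hn : 2 ≤ n) (hf : IsParameter n 1 f) {γ : Polynomial K}
    (hγ0 : γ.coeff 0 = 0) (hγ1 : γ.coeff 1 = 1)
    (hγf : X ^ n ∣ (γ : K⟦X⟧) * derivative K f - f * (f - 1)) {P : K⟦X⟧⟦X⟧}
    (hP0 : ∀ i < n, coeff i (coeff 0 P) = if i = 1 then 1 else 0) (hP01 : coeff 0 (coeff 1 P) = 0)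
    (h : PowerSeries.map C f * Polynomial.aeval P γ - (fieldX γ P + fieldY γ P) ∈
      truncIdeal K n) : P - G 1 f ∈ truncIdeal K n := by
  have hg0 : coeff 0 (γ : K⟦X⟧) = 0 := by rw [Polynomial.coeff_coe, hγ0]
  have hg1 : coeff 1 (γ : K⟦X⟧) = 1 := by rw [Polynomial.coeff_coe, hγ1]
  -- The derivative of f has constant term 1, hence can be divided out of the congruence for γ.
  have hdiv : X ^ n ∣ (γ : K⟦X⟧) - g 1 f := by
    have h1 : X ^ n ∣ ((γ : K⟦X⟧) - g 1 f) * derivative K f := by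
      rw [sub_mul, g_mul_derivative hf, pow_one]; exact hγf
    have hu : IsUnit (derivative K f) := by
      rw [isUnit_iff_constantCoeff, ← coeff_zero_eq_constantCoeff_apply, coeff_derivative]
      simp [hf.coeff_deg]
    exact hu.dvd_mul_right.1 h1
  set N := PowerSeries.map C f * Polynomial.aeval P γ - (fieldX γ P + fieldY γ P) with hN
  set gP := Polynomial.aeval P γ with hgP
  set gP' := Polynomial.aeval P (Polynomial.derivative γ) with hgP'
  -- With E = γ(P) - γ(x) P_x, applying γ(x) ∂/∂x to the hypothesis gives (γ(x)∂/∂x + γ(y)∂/∂y) E =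
  -- f(y) γ'(P) E up to truncation, because the two fields commute. The factor f(y) γ'(P) has
  -- constant term 1, so only the degree 1 part of E needs checking by hand.
  have hE : gP - fieldX (γ : K⟦X⟧) P ∈ truncIdeal K n := by
    have hX : fieldX (γ : K⟦X⟧) gP = gP' * fieldX (γ : K⟦X⟧) P := by
      rw [hgP, Derivation.map_aeval, smul_eq_mul]
    have hY : fieldY (γ : K⟦X⟧) gP = gP' * fieldY (γ : K⟦X⟧) P := by
      rw [hgP, Derivation.map_aeval, smul_eq_mul]
    have hNX : fieldX (γ : K⟦X⟧) (PowerSeries.map C f * gP - N) =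
        fieldX (γ : K⟦X⟧) (fieldX (γ : K⟦X⟧) P + fieldY (γ : K⟦X⟧) P) := by
      rw [hN]; congr 1; ring
    rw [map_sub, map_add, fieldX_map_C_mul, hX] at hNX
    have hPc : constantCoeff (constantCoeff P) = 0 := by
      rw [← coeff_zero_eq_constantCoeff_apply, ← coeff_zero_eq_constantCoeff_apply,
        hP0 0 (by omega), if_neg (by omega)]
    -- As γ = x + ⋯ and P has no constant term, γ(P) and P agree in degree 1.
    have hgPexp : ∃ Q, gP = P + P * P * Q := by
      refine ⟨Polynomial.aeval P γ.divX.divX, ?_⟩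
      have h1 : γ = Polynomial.X + Polynomial.X * Polynomial.X * γ.divX.divX := by
        conv_lhs => rw [← Polynomial.divX_mul_X_add γ, ← Polynomial.divX_mul_X_add γ.divX]
        rw [Polynomial.coeff_divX, hγ0, hγ1, map_zero, map_one]
        ring
      rw [hgP]
      conv_lhs => rw [h1]
      simp
    obtain ⟨Q, hQ⟩ := hgPexp
    have hQ' : gP = P + P * Q * P := by rw [hQ]; ring
    have hPQ : coeff 0 (coeff 0 (P * Q)) = 0 := by
      rw [coeff_zero_eq_constantCoeff_apply, coeff_zero_eq_constantCoeff_apply, map_mul, map_mul,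
        hPc, zero_mul]
    refine mem_truncIdeal_of_euler hg0 hg1 (u := PowerSeries.map C f * gP') ?_ ?_ ?_ ?_
    · rw [coeff_zero_eq_constantCoeff_apply, coeff_zero_eq_constantCoeff_apply, map_mul, map_mul]
      have hfc : constantCoeff (constantCoeff (PowerSeries.map (C : K →+* K⟦X⟧) f)) = 1 := by
        simp only [← coeff_zero_eq_constantCoeff_apply, coeff_map, hf.coeff_zero]
        simp
      have h1 : constantCoeff (constantCoeff gP') = 1 := by
        rw [hgP', Polynomial.aeval_def, Polynomial.hom_eval₂, Polynomial.hom_eval₂, hPc,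
          Polynomial.eval₂_at_zero, Polynomial.coeff_derivative]
        simp [hγ1]
      rw [h1, hfc, mul_one]
    · rw [hQ', map_sub, map_sub, map_add, map_add, coeff_coeff_mul_of_lt, hPQ, hP0 1 (by omega),
        coeff_fieldX_of_lt hg0 hg1, hP0 1 (by omega)]
      · simp
      · intro i hi
        rw [Nat.lt_one_iff.1 hi, hP0 0 (by omega), if_neg (by omega)]
      · intro i hi j hj hlt
        obtain rfl : i = 0 := by omega
        obtain rfl : j = 0 := by omega
        rw [hP0 0 (by omega), if_neg (by omega)]
    · rw [hQ', map_sub, map_sub, map_add, map_add, coeff_coeff_mul_of_lt, hPQ, hP01,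
        coeff_fieldX_of_lt hg0 hg1 (fun i hi => absurd hi (Nat.not_lt_zero i))]
      · simp
      · intro i hi j hj hlt
        obtain rfl : i = 0 := by omega
        obtain rfl : j = 0 := by omega
        rw [hP0 0 (by omega), if_neg (by omega)]
    · have e : fieldX (γ : K⟦X⟧) (gP - fieldX (γ : K⟦X⟧) P) +
          fieldY (γ : K⟦X⟧) (gP - fieldX (γ : K⟦X⟧) P) -
          PowerSeries.map C f * gP' * (gP - fieldX (γ : K⟦X⟧) P) =
          fieldX (γ : K⟦X⟧) N - gP' * N := by
        rw [map_sub, map_sub, fieldY_fieldX, hX, hY, hN]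
        linear_combination hNX
      rw [e]
      exact sub_mem (fieldX_mem_truncIdeal hg0 h) (Ideal.mul_mem_left _ _ h)
  -- Substituting E = 0 in the hypothesis gives γ(y) P_y = (f(y)-1) γ(x) P_x, the equation of G with
  -- g replaced by γ. The terms with γ - g are negligible by `hdiv`.
  refine mem_truncIdeal_of_fieldY hg0 hg1 (u := PowerSeries.map C (f - 1)) ?_ ?_ ?_
  · rw [coeff_map, map_sub, hf.coeff_zero]
    simp
  · intro i hi
    rw [map_sub, map_sub, hP0 i hi, (G_spec hf).1, coeff_X, sub_self]
  · have hG := fieldY_G hf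
    have e : fieldY (γ : K⟦X⟧) (P - G 1 f) -
        PowerSeries.map C (f - 1) * fieldX (γ : K⟦X⟧) (P - G 1 f) =
        PowerSeries.map C f * (gP - fieldX (γ : K⟦X⟧) P) - N -
          PowerSeries.map C ((γ : K⟦X⟧) - g 1 f) * derivative K⟦X⟧ (G 1 f) +
          C ((γ : K⟦X⟧) - g 1 f) * (PowerSeries.map C (f - 1) * derivX (G 1 f)) := by
      rw [hN]
      simp only [map_sub, fieldX_apply, fieldY_apply, map_one] at hG ⊢
      linear_combination (-1 : K⟦X⟧⟦X⟧) * hG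
    rw [e]
    exact add_mem (sub_mem (sub_mem (Ideal.mul_mem_left _ _ hE) h)
      (Ideal.mul_mem_right _ _ (map_C_mem_truncIdeal hdiv)))
      (Ideal.mul_mem_right _ _ (C_mem_truncIdeal hdiv))

end Standard

/-! ### From the cycle identities to the standard series. -/

namespace TruncDual

open PowerSeries Standard

variable {K : Type*} [Field K] {n : ℕ}

section Evaluation

variable {R R' : Type*} [CommRing R] [Algebra K R] [CommRing R'] [Algebra K R']
variable (m : TruncDual K n ⊗[K] TruncDual K n →ₗc[K] TruncDual K n)

theorem map_evalX (φ : R →ₐ[K] R') (s t : R) : φ (evalX m s t) = evalX m (φ s) (φ t) := by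
  simp [evalX, map_sum]

theorem map_evalY (φ : R →ₐ[K] R') (s t : R) : φ (evalY m s t) = evalY m (φ s) (φ t) := by
  simp [evalY, map_sum]

/-- The series `∑ m_{1j}^1 x^j`. -/
noncomputable def rowSeries : K⟦X⟧ := PowerSeries.mk fun j => structCoeff m 1 j 1

@[simp]
theorem coeff_rowSeries (j : ℕ) : PowerSeries.coeff j (rowSeries m) = structCoeff m 1 j 1 := by
  simp [rowSeries]

/-- The polynomial `∑ m_{i1}^1 x^i`. -/
noncomputable def colPoly : Polynomial K :=
  ∑ i ∈ Finset.range n, Polynomial.monomial i (structCoeff m i 1 1)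

theorem coeff_colPoly (i : ℕ) : (colPoly m).coeff i = structCoeff m i 1 1 := by
  rw [colPoly, Polynomial.finsetSum_coeff]
  simp only [Polynomial.coeff_monomial, Finset.sum_ite_eq', Finset.mem_range]
  split_ifs with h
  · rfl
  · exact (structCoeff_of_le_left m (not_lt.1 h) 1 1).symm

theorem evalY_zero_right_eq_aeval (hn : 2 ≤ n) (s : R) :
    evalY m s 0 = Polynomial.aeval s (colPoly m) := by
  rw [evalY_zero_right m hn, colPoly, map_sum]
  simp [Polynomial.aeval_monomial]

theorem aeval_X_eq_map_C (γ : Polynomial K) :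
    Polynomial.aeval (X : K⟦X⟧⟦X⟧) γ = PowerSeries.map C (γ : K⟦X⟧) := by
  induction γ using Polynomial.induction_on' with
  | add a b ha hb => rw [map_add, ha, hb, Polynomial.coe_add, map_add]
  | monomial k c =>
    rw [Polynomial.aeval_monomial, Polynomial.coe_monomial, algebraMap_powerSeries]
    ext1 v
    rw [coeff_map, coeff_monomial, coeff_C_mul, coeff_X_pow]
    split_ifs <;> simp

theorem aeval_C_X_eq_C (γ : Polynomial K) :
    Polynomial.aeval (C (X : K⟦X⟧) : K⟦X⟧⟦X⟧) γ = C (γ : K⟦X⟧) := by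
  induction γ using Polynomial.induction_on' with
  | add a b ha hb => rw [map_add, ha, hb, Polynomial.coe_add, map_add]
  | monomial k c =>
    rw [Polynomial.aeval_monomial, Polynomial.coe_monomial, algebraMap_powerSeries, ← map_pow,
      ← map_mul]
    congr 1
    ext v
    rw [coeff_monomial, coeff_C_mul, coeff_X_pow]
    split_ifs <;> simp

theorem evalX_zero_X (hn : 2 ≤ n) :
    evalX m (0 : K⟦X⟧⟦X⟧) X = PowerSeries.map C (rowSeries m) := by
  rw [evalX_zero_left m hn]
  ext1 j
  simp only [algebraMap_powerSeries, map_sum, coeff_C_mul, coeff_X_pow, coeff_map, mul_ite,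
    mul_one, mul_zero, Finset.sum_ite_eq, coeff_rowSeries, Finset.mem_range]
  split_ifs with h
  · rfl
  · rw [structCoeff_of_le_right m 1 (not_lt.1 h), map_zero]

end Evaluation

variable {p d : TruncDual K n ⊗[K] TruncDual K n →ₗc[K] TruncDual K n}

theorem mkₐ_C_X_pow : Ideal.Quotient.mkₐ K (truncIdeal K n) (C (X : K⟦X⟧)) ^ n = 0 := by
  rw [← map_pow, Ideal.Quotient.mkₐ_eq_mk, Ideal.Quotient.eq_zero_iff_mem]
  exact C_X_pow_mem_truncIdeal n

theorem mkₐ_X_pow : Ideal.Quotient.mkₐ K (truncIdeal K n) X ^ n = 0 := by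
  rw [← map_pow, Ideal.Quotient.mkₐ_eq_mk, Ideal.Quotient.eq_zero_iff_mem]
  exact X_pow_mem_truncIdeal n

/-- An identity valid at all points is evaluated at the class of (x, y), where it becomes a
differential equation up to truncation. -/
theorem mem_truncIdeal_of_evalPt (hn : 2 ≤ n)
    {m : TruncDual K n ⊗[K] TruncDual K n →ₗc[K] TruncDual K n}
    (h : ∀ a b : K⟦X⟧⟦X⟧ ⧸ truncIdeal K n, a ^ n = 0 → b ^ n = 0 →
      evalX d 0 b * evalY p (evalPt m a b) 0 =
        evalY p a 0 * evalX m a b + evalY p b 0 * evalY m a b) :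
    PowerSeries.map C (rowSeries d) * Polynomial.aeval (series m) (colPoly p) -
      (fieldX (colPoly p) (series m) + fieldY (colPoly p) (series m)) ∈ truncIdeal K n := by
  have e := h _ _ mkₐ_C_X_pow mkₐ_X_pow
  rw [← map_zero (Ideal.Quotient.mkₐ K (truncIdeal K n)), ← map_evalPt] at e
  simp only [← map_evalX, ← map_evalY, ← map_mul, ← map_add] at e
  rw [evalX_series, evalY_series, evalPt_series, evalX_zero_X d hn,
    evalY_zero_right_eq_aeval p hn, evalY_zero_right_eq_aeval p hn, evalY_zero_right_eq_aeval p hn,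
    aeval_X_eq_map_C, aeval_C_X_eq_C, Ideal.Quotient.mkₐ_eq_mk] at e
  exact Ideal.Quotient.eq.1 e

section Row

variable {m : TruncDual K n ⊗[K] TruncDual K n →ₗc[K] TruncDual K n} {γ : Polynomial K}
variable {φ : K⟦X⟧}

/-- The part linear in `x` of an identity `φ(y) γ(m) = γ(x) m_x + γ(y) m_y`. -/
theorem X_pow_dvd_of_mem_truncIdeal (hn : 2 ≤ n) (hm : ∀ j < n, structCoeff m 0 j 1 = 0)
    (hγ0 : γ.coeff 0 = 0) (hγ1 : γ.coeff 1 = 1)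
    (h : PowerSeries.map C φ * Polynomial.aeval (series m) γ -
      (fieldX γ (series m) + fieldY γ (series m)) ∈ truncIdeal K n) :
    X ^ n ∣ φ * rowSeries m - (rowSeries m + (γ : K⟦X⟧) * derivative K (rowSeries m)) := by
  have hm' : ∀ j, structCoeff m 0 j 1 = 0 := fun j =>
    (lt_or_ge j n).elim (hm j) fun hj => structCoeff_of_le_right m 0 hj 1
  have hγ : γ = Polynomial.X + Polynomial.X * Polynomial.X * γ.divX.divX := by
    conv_lhs => rw [← Polynomial.divX_mul_X_add γ, ← Polynomial.divX_mul_X_add γ.divX]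
    rw [Polynomial.coeff_divX, hγ0, hγ1, map_zero, map_one]
    ring
  obtain ⟨U, hU⟩ : ∃ U, series m = C (X : K⟦X⟧) * U := by
    refine ⟨PowerSeries.mk fun j => PowerSeries.mk fun i => structCoeff m (i + 1) j 1, ?_⟩
    ext j i
    rw [coeff_coeff_series, coeff_C_mul, coeff_mk]
    rcases i with _ | i
    · simp [hm' j]
    · rw [coeff_succ_X_mul, coeff_mk]
  have hrow : ∀ j, PowerSeries.coeff 1 (PowerSeries.coeff j (Polynomial.aeval (series m) γ)) =
      structCoeff m 1 j 1 := by
    intro j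
    -- The series is divisible by x and γ = x + ⋯, so γ(m) and m have the same part linear in x.
    have : Polynomial.aeval (series m) γ = series m + C (X ^ 2 : K⟦X⟧) *
        (U * U * Polynomial.aeval (series m) γ.divX.divX) := by
      conv_lhs => rw [hγ]
      simp only [map_add, map_mul, Polynomial.aeval_X, map_pow]
      rw [hU]; ring
    rw [this, map_add, map_add, coeff_C_mul, coeff_coeff_series, coeff_X_pow_mul',
      if_neg (by omega), add_zero]
  rw [X_pow_dvd_iff]
  intro v hv
  have e := h 1 (by omega) v hv
  rw [map_sub, map_sub, map_add, map_add, coeff_fieldX_of_lt (by rw [Polynomial.coeff_coe, hγ0])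
    (by rw [Polynomial.coeff_coe, hγ1]), coeff_coeff_series, coeff_fieldY] at e
  · rw [← e, map_sub, map_add, coeff_rowSeries, PowerSeries.coeff_mul, PowerSeries.coeff_mul,
      PowerSeries.coeff_mul, map_sum]
    simp only [coeff_map, coeff_C_mul, hrow, coeff_rowSeries, coeff_derivative, coeff_coeff_series]
    simp
  · intro i hi
    rw [Nat.lt_one_iff.1 hi, coeff_coeff_series, hm']

end Row

/-- Two solutions of `f h = f + γ f'` and `h h = h + γ h'` modulo `x^n` agree modulo `x^n`. -/
theorem X_pow_dvd_sub_of_dvd [CharZero K] {f h γ : K⟦X⟧} (hγ0 : PowerSeries.coeff 0 γ = 0)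
    (hγ1 : PowerSeries.coeff 1 γ = 1) (hf0 : PowerSeries.coeff 0 f = 1)
    (hh0 : PowerSeries.coeff 0 h = 1)
    (hf : X ^ n ∣ h * f - (f + γ * derivative K f))
    (hh : X ^ n ∣ h * h - (h + γ * derivative K h)) : X ^ n ∣ h - f := by
  obtain ⟨u, rfl⟩ : X ∣ γ := X_dvd_iff.2 (by rwa [← coeff_zero_eq_constantCoeff_apply])
  have hu : constantCoeff u = 1 := by
    rw [← hγ1, ← zero_add 1, coeff_succ_X_mul, coeff_zero_eq_constantCoeff_apply]
  -- Taking h times the first relation minus f times the second eliminates the undifferentiated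
  -- terms, leaving γ times the Wronskian of f and h.
  have hdvd : X ^ n ∣ X * u * (derivative K (h - f) * f - (h - f) * derivative K f) := by
    have := dvd_sub (hf.mul_left h) (hh.mul_left f)
    rw [map_sub]
    convert this using 1
    ring
  suffices H : ∀ k ≤ n, X ^ k ∣ h - f from H n le_rfl
  intro k
  induction k with
  | zero => intro _; simp
  | succ k ih =>
    intro hk
    rcases Nat.eq_zero_or_pos k with rfl | hk0
    · rw [zero_add, pow_one, X_dvd_iff, map_sub, ← coeff_zero_eq_constantCoeff_apply,
        ← coeff_zero_eq_constantCoeff_apply, hf0, hh0, sub_self]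
    obtain ⟨w, hw⟩ := ih (by omega)
    have hd : X * derivative K (h - f) = X ^ k * ((k : K⟦X⟧) * w) + X ^ (k + 1) * derivative K w :=
      by
      rw [hw, Derivation.leibniz, derivative_pow, derivative_X, smul_eq_mul, smul_eq_mul]
      obtain ⟨l, rfl⟩ : ∃ l, k = l + 1 := ⟨k - 1, by omega⟩
      rw [Nat.add_sub_cancel]
      ring
    -- If h - f starts at x^k, the Wronskian relation starts with k times its leading coefficient,
    -- since f and u have constant term 1. In characteristic zero that coefficient vanishes for k ≥
    -- 1.
    have h2 : X ^ (k + 1) ∣ X ^ k * ((k : K⟦X⟧) * w * u * f) := by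
      have h3 := (pow_dvd_pow (X : K⟦X⟧) hk).trans hdvd
      have h4 : X * u * (derivative K (h - f) * f - (h - f) * derivative K f) =
          X ^ k * ((k : K⟦X⟧) * w * u * f) +
            X ^ (k + 1) * (u * (derivative K w * f - w * derivative K f)) := by
        calc _ = u * ((X * derivative K (h - f)) * f) - X * u * (h - f) * derivative K f := by ring
          _ = _ := by rw [hd, hw]; ring
      rw [h4] at h3
      exact (dvd_add_left (dvd_mul_right _ _)).1 h3
    rw [pow_succ, mul_dvd_mul_iff_left (pow_ne_zero _ X_ne_zero), X_dvd_iff] at h2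
    rw [hw, pow_succ]
    refine mul_dvd_mul_left _ (X_dvd_iff.2 ?_)
    rw [coeff_zero_eq_constantCoeff_apply] at hf0
    simpa [hu, hf0, hk0.ne'] using h2

/-- A regular `q`-cycle coalgebra with `p_{11}^1 = 1` has the structure constants of a standard
cycle coalgebra. -/
theorem _root_.IsRegularQCycleCoalgebra.exists_eq_G [CharZero K] (hn : 2 ≤ n)
    (h : IsRegularQCycleCoalgebra p d) (h11 : structCoeff p 1 1 1 = 1) :
    IsParameter n 1 (rowSeries p) ∧ ∀ i < n, ∀ j < n,
      structCoeff p i j 1 = PowerSeries.coeff i (PowerSeries.coeff j (G 1 (rowSeries p))) ∧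
      structCoeff d i j 1 = PowerSeries.coeff i (PowerSeries.coeff j (G 1 (rowSeries p))) := by
  have h11' : structCoeff p 1 1 1 ≠ 0 := by rw [h11]; exact one_ne_zero
  have hp0 := structCoeff_zero_left p hn (h.structCoeff_one_zero_fst hn)
  have hd0 := structCoeff_zero_left d hn (h.structCoeff_one_zero_snd hn)
  have hγ0 : (colPoly p).coeff 0 = 0 := by rw [coeff_colPoly, hp0 1 (by omega)]
  have hγ1 : (colPoly p).coeff 1 = 1 := by rw [coeff_colPoly, h11]
  have hp := mem_truncIdeal_of_evalPt hn fun a b ha hb => h.evalPt_deriv_fst hn h11' ha hb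
  have hd := mem_truncIdeal_of_evalPt hn fun a b ha hb => h.evalPt_deriv_snd hn h11' ha hb
  have hinit : ∀ (m : TruncDual K n ⊗[K] TruncDual K n →ₗc[K] TruncDual K n),
      (∀ t : K⟦X⟧⟦X⟧ ⧸ truncIdeal K n, t ^ n = 0 → evalPt m t 0 = t) →
      ∀ i < n, PowerSeries.coeff i (PowerSeries.coeff 0 (series m)) = if i = 1 then 1 else 0 := by
    intro m hm i hi
    have e := hm _ mkₐ_C_X_pow
    rw [← map_zero (Ideal.Quotient.mkₐ K (truncIdeal K n)), ← map_evalPt,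
      Ideal.Quotient.mkₐ_eq_mk] at e
    have e' := Ideal.Quotient.eq.1 e i hi 0 (by omega)
    rw [map_sub, map_sub, coeff_C, if_pos rfl, coeff_X, sub_eq_zero] at e'
    rw [← e', coeff_coeff_series, evalPt, evalPow, map_sum, map_sum]
    rw [Finset.sum_eq_single i, Finset.sum_eq_single 0]
    · rw [algebraMap_powerSeries, pow_zero, mul_one, ← map_pow, ← map_mul, coeff_C, if_pos rfl,
        coeff_C_mul, coeff_X_pow, if_pos rfl, mul_one]
    · intro j _ hj; simp [hj]
    · intro h0; exact absurd (Finset.mem_range.2 (by omega)) h0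
    · intro k _ hk
      rw [Finset.sum_eq_single 0]
      · rw [algebraMap_powerSeries, pow_zero, mul_one, ← map_pow, ← map_mul, coeff_C, if_pos rfl,
          coeff_C_mul, coeff_X_pow, if_neg hk.symm, mul_zero]
      · intro j _ hj; simp [hj]
      · intro h0; exact absurd (Finset.mem_range.2 (by omega)) h0
    · intro h0; exact absurd (Finset.mem_range.2 hi) h0
  have hip := hinit p fun t ht => h.evalPt_fst_zero hn h11' ht
  have hid := hinit d fun t ht => h.evalPt_snd_zero hn h11' ht
  have hp10 : structCoeff p 1 0 1 = 1 := (coeff_coeff_series p 1 0).symm.trans (hip 1 (by omega))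
  have hd10 : structCoeff d 1 0 1 = 1 := (coeff_coeff_series d 1 0).symm.trans (hid 1 (by omega))
  have hf : IsParameter n 1 (rowSeries p) :=
    { pos := one_pos
      coeff_zero := by rw [coeff_rowSeries, hp10]
      coeff_lt := fun v h0 h1 => by omega
      coeff_deg := by rw [coeff_rowSeries, h11]
      coeff_ge := fun v hv => by rw [coeff_rowSeries, structCoeff_of_le_right p 1 hv] }
  have hpr := X_pow_dvd_of_mem_truncIdeal hn hp0 hγ0 hγ1 hp
  have hdr := X_pow_dvd_of_mem_truncIdeal hn hd0 hγ0 hγ1 hd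
  -- Both rows solve the equations in `X_pow_dvd_sub_of_dvd`, with h the row of d; from here on p
  -- and d satisfy the same equation.
  have hrow : rowSeries d = rowSeries p := by
    have := X_pow_dvd_sub_of_dvd (by rw [Polynomial.coeff_coe, hγ0])
      (by rw [Polynomial.coeff_coe, hγ1]) hf.coeff_zero (by rw [coeff_rowSeries, hd10]) hpr hdr
    ext v
    rcases lt_or_ge v n with hv | hv
    · exact sub_eq_zero.1 (by rw [← map_sub]; exact X_pow_dvd_iff.1 this v hv)
    · rw [coeff_rowSeries, coeff_rowSeries, structCoeff_of_le_right _ _ hv,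
        structCoeff_of_le_right _ _ hv]
  rw [hrow] at hp hd hpr
  have hγf : X ^ n ∣ (colPoly p : K⟦X⟧) * derivative K (rowSeries p) -
      rowSeries p * (rowSeries p - 1) := by
    rw [← dvd_neg]
    convert hpr using 1
    ring
  have hpG := sub_G_mem_truncIdeal hn hf hγ0 hγ1 hγf hip
    (by rw [coeff_coeff_series, hp0 1 (by omega)]) hp
  have hdG := sub_G_mem_truncIdeal hn hf hγ0 hγ1 hγf hid
    (by rw [coeff_coeff_series, hd0 1 (by omega)]) hd
  refine ⟨hf, fun i hi j hj => ⟨?_, ?_⟩⟩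
  · simpa [sub_eq_zero] using hpG i hi j hj
  · simpa [sub_eq_zero] using hdG i hi j hj

end TruncDual

/-! ### Involutivity, and recovery of the data from structure constants. -/

namespace TruncDual

open PowerSeries Standard

variable {K : Type*} [Field K] {n : ℕ}

section Braiding

variable {R : Type*} [CommRing R] [Algebra K R]

/-- The coefficient of `x_u ⊗ x_v`. -/
noncomputable def coeffTensor (u v : ℕ) : TruncDual K n ⊗[K] TruncDual K n →ₗ[K] K :=
  LinearMap.mul' K K ∘ₗ TensorProduct.map (coeffLin u) (coeffLin v)

theorem coeffTensor_tmul (u v : ℕ) (a b : TruncDual K n) :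
    coeffTensor u v (a ⊗ₜ b) = coeff u a * coeff v b := by
  simp [coeffTensor, coeffLin_apply]

theorem sum_coeffTensor_smul (w : TruncDual K n ⊗[K] TruncDual K n) :
    ∑ u ∈ Finset.range n, ∑ v ∈ Finset.range n, coeffTensor u v w • x K n u ⊗ₜ[K] x K n v = w := by
  induction w with
  | zero => simp
  | tmul a b =>
    conv_rhs => rw [← sum_coeff_smul_x a, ← sum_coeff_smul_x b]
    simp only [TensorProduct.sum_tmul, TensorProduct.tmul_sum, coeffTensor_tmul,
      TensorProduct.smul_tmul_smul]
    rw [Finset.sum_comm]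
  | add a b ha hb =>
    conv_rhs => rw [← ha, ← hb]
    simp only [map_add, add_smul, Finset.sum_add_distrib]

variable (p r : TruncDual K n ⊗[K] TruncDual K n →ₗc[K] TruncDual K n)

theorem leftAction_tmul (a b : TruncDual K n) :
    leftAction p.toLinearMap r.toLinearMap (a ⊗ₜ b) =
      sweedler p.toLinearMap LinearMap.id (leftArg r.toLinearMap a) b := by
  rw [← sweedlerOp_eq_sweedler]
  simp only [leftAction, sweedlerOp, LinearMap.comp_apply, LinearMap.lTensor_tmul]
  generalize Coalgebra.comul (R := K) b = w
  induction w with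
  | zero => simp
  | tmul c e => simp [leftArg]
  | add c e hc he => simp only [TensorProduct.tmul_add, map_add, hc, he]

theorem evalArray_leftAction (hn : 0 < n) (u : ℕ) {s t : R} (hs : s ^ n = 0) (ht : t ^ n = 0) :
    evalArray n (fun i j => coeff u (leftAction p.toLinearMap r.toLinearMap
      (x K n i ⊗ₜ x K n j))) s t = evalPt p t (evalPt r s t) ^ u := by
  rw [← evalPow_eq_pow p hn ht (evalPt_pow_eq_zero r hn hs ht), evalPow]
  have h : ∀ i, ∑ j ∈ Finset.range n, algebraMap K R (coeff u (leftAction p.toLinearMap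
      r.toLinearMap (x K n i ⊗ₜ x K n j))) * s ^ i * t ^ j =
      ∑ k ∈ Finset.range n, ∑ l ∈ Finset.range n, algebraMap K R (structCoeff p k l u) * t ^ k *
        (s ^ i * evalLin (leftArg r.toLinearMap (x K n i)) l t) := by
    intro i
    have e := sum_coeff_sweedler p LinearMap.id (leftArg r.toLinearMap (x K n i)) u ht
    simp only [leftAction_tmul]
    calc _ = s ^ i * ∑ j ∈ Finset.range n, algebraMap K R (coeff u (sweedler p.toLinearMap
          LinearMap.id (leftArg r.toLinearMap (x K n i)) (x K n j))) * t ^ j := by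
          rw [Finset.mul_sum]
          exact Finset.sum_congr rfl fun j _ => by ring
      _ = _ := by
          rw [e, Finset.mul_sum]
          refine Finset.sum_congr rfl fun k hk => ?_
          rw [Finset.mul_sum]
          refine Finset.sum_congr rfl fun l _ => ?_
          rw [evalLin_id (Finset.mem_range.1 hk)]
          ring
  unfold evalArray
  simp only [h]
  rw [Finset.sum_comm]
  refine Finset.sum_congr rfl fun k _ => ?_
  rw [Finset.sum_comm]
  refine Finset.sum_congr rfl fun l _ => ?_
  rw [← evalPow_eq_pow r hn hs ht, ← sum_evalLin_leftArg, Finset.mul_sum]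

/-- On points, the braiding is `(s, t) ↦ (t · sᵗ, sᵗ)`. -/
theorem evalArray_braiding (hn : 0 < n) (u v : ℕ) {s t : R} (hs : s ^ n = 0) (ht : t ^ n = 0) :
    evalArray n (fun i j => coeffTensor u v (braiding p.toLinearMap r.toLinearMap
      (x K n i ⊗ₜ x K n j))) s t = evalPt p t (evalPt r s t) ^ u * evalPt r s t ^ v := by
  rw [← evalArray_leftAction p r hn u hs ht, ← evalPow_eq_pow r hn hs ht v]
  have hr : evalPow r v s t = evalArray n (fun i j => structCoeff r i j v) s t := rfl
  rw [hr, ← evalArray_conv _ _ hs ht]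
  unfold evalArray
  refine Finset.sum_congr rfl fun i hi => Finset.sum_congr rfl fun j hj => ?_
  congr 3
  simp only [braiding, LinearMap.comp_apply, TensorProduct.map_tmul,
    comul_x (Finset.mem_range.1 hi), comul_x (Finset.mem_range.1 hj), map_sum, LinearEquiv.coe_coe,
    TensorProduct.comm_tmul, TensorProduct.sum_tmul, TensorProduct.tmul_sum,
    TensorProduct.tensorTensorTensorComm_tmul, coeffTensor_tmul]
  rw [Finset.sum_comm]
  refine Finset.sum_congr rfl fun a _ => ?_
  exact Finset.Nat.sum_antidiagonal_swap (f := fun b =>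
    coeff u (leftAction p.toLinearMap r.toLinearMap (x K n a.1 ⊗ₜ x K n b.1)) *
      coeff v (r.toLinearMap (x K n a.2 ⊗ₜ x K n b.2)))

variable {p r}

/-- Let β = sᵗ. The solution sends (s, t) to (t · β, β), and applying it again needs (t · β)^β = t
and β · t = s. These are the two halves of `IsInverseAction`. -/
theorem braiding_comp_braiding (hn : 2 ≤ n)
    (h : IsInverseAction p.toLinearMap r.toLinearMap) :
    braiding p.toLinearMap r.toLinearMap ∘ₗ braiding p.toLinearMap r.toLinearMap =
      LinearMap.id := by
  set b := braiding p.toLinearMap r.toLinearMap with hb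
  have hn0 : 0 < n := by omega
  -- All coefficients with indices below n can be read off at the generic point modulo `truncIdeal`.
  have key : ∀ w z, evalArray n (fun i j => coeffTensor w z (b (b (x K n i ⊗ₜ x K n j))))
      (Ideal.Quotient.mkₐ K (truncIdeal K n) (C (X : K⟦X⟧)))
      (Ideal.Quotient.mkₐ K (truncIdeal K n) X) =
      Ideal.Quotient.mkₐ K (truncIdeal K n) (C (X : K⟦X⟧)) ^ w *
        Ideal.Quotient.mkₐ K (truncIdeal K n) X ^ z := by
    intro w z
    set s := Ideal.Quotient.mkₐ K (truncIdeal K n) (C (X : K⟦X⟧)) with hs'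
    set t := Ideal.Quotient.mkₐ K (truncIdeal K n) X with ht'
    have hs : s ^ n = 0 := mkₐ_C_X_pow
    have ht : t ^ n = 0 := mkₐ_X_pow
    have hβ := evalPt_pow_eq_zero r hn0 hs ht
    have hα := evalPt_pow_eq_zero p hn0 ht hβ
    have h1 := evalPt_sweedler_id hn (fun a c => (h a c).1) hs ht
    have h2 := evalPt_sweedler_id hn (fun a c => (h a c).2) ht hβ
    have e := evalArray_braiding p r hn0 w z hα hβ
    rw [h2, h1, ← hb] at e
    rw [← e]
    have hexp : ∀ i j, coeffTensor w z (b (b (x K n i ⊗ₜ x K n j))) =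
        ∑ u ∈ Finset.range n, ∑ v ∈ Finset.range n, coeffTensor u v (b (x K n i ⊗ₜ x K n j)) *
          coeffTensor w z (b (x K n u ⊗ₜ x K n v)) := by
      intro i j
      conv_lhs => rw [← sum_coeffTensor_smul (b (x K n i ⊗ₜ x K n j))]
      simp only [map_sum, map_smul, smul_eq_mul]
    unfold evalArray
    simp only [hexp, map_sum, map_mul, Finset.sum_mul]
    rw [sum_sum_comm_sum_sum]
    refine Finset.sum_congr rfl fun u _ => Finset.sum_congr rfl fun v _ => ?_
    rw [mul_assoc, ← evalArray_braiding p r hn0 u v hs ht, ← hb, evalArray, Finset.mul_sum]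
    refine Finset.sum_congr rfl fun i _ => ?_
    rw [Finset.mul_sum]
    exact Finset.sum_congr rfl fun j _ => by ring
  refine tensor_ext fun i hi j hj => ?_
  rw [LinearMap.comp_apply, LinearMap.id_apply, ← sum_coeffTensor_smul (b (b _)),
    ← sum_coeffTensor_smul (x K n i ⊗ₜ[K] x K n j)]
  refine Finset.sum_congr rfl fun w hw => Finset.sum_congr rfl fun z hz => ?_
  rw [sum_coeffTensor_smul]
  congr 1
  have e := key w z
  have hmk : evalArray n (fun i j => coeffTensor w z (b (b (x K n i ⊗ₜ x K n j))))
      (Ideal.Quotient.mkₐ K (truncIdeal K n) (C (X : K⟦X⟧)))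
      (Ideal.Quotient.mkₐ K (truncIdeal K n) X) =
      Ideal.Quotient.mkₐ K (truncIdeal K n) (PowerSeries.mk fun j => PowerSeries.mk fun i =>
        coeffTensor w z (b (b (x K n i ⊗ₜ x K n j)))) := by
    rw [← sum_C_C_mul_eq_mk (n := n)]
    · simp [evalArray, map_sum]
    · intro i j h
      rcases h with h | h
      · rw [x_of_le h]; simp
      · rw [x_of_le h]; simp
  rw [hmk, ← map_pow, ← map_pow (Ideal.Quotient.mkₐ K (truncIdeal K n)), ← map_mul,
    Ideal.Quotient.mkₐ_eq_mk] at e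
  have e' := Ideal.Quotient.eq.1 e i hi j hj
  rw [map_sub, map_sub, coeff_mk, coeff_mk, sub_eq_zero] at e'
  rw [e', coeffTensor_tmul, coeff_x hi, coeff_x hj, ← map_pow, coeff_C_mul, coeff_X_pow]
  by_cases h1 : i = w <;> by_cases h2 : j = z <;> simp [h1, h2, coeff_X_pow]

end Braiding

/-- The algebra K[y]/(yⁿ) is generated by y, so the first coordinate series determines all the
others. -/
theorem coalgHom_ext {m m' : TruncDual K n ⊗[K] TruncDual K n →ₗc[K] TruncDual K n}
    (h : ∀ i < n, ∀ j < n, structCoeff m i j 1 = structCoeff m' i j 1) : m = m' := by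
  have hk : ∀ k i j, i < n → j < n → structCoeff m i j k = structCoeff m' i j k := by
    intro k
    induction k with
    | zero => intro i j hi hj; rw [structCoeff_zero m hi hj, structCoeff_zero m' hi hj]
    | succ k ih =>
      intro i j hi hj
      rw [structCoeff_add m hi hj, structCoeff_add m' hi hj]
      refine Finset.sum_congr rfl fun a ha => Finset.sum_congr rfl fun b hb => ?_
      have := Finset.HasAntidiagonal.mem_antidiagonal.1 ha
      have := Finset.HasAntidiagonal.mem_antidiagonal.1 hb
      rw [ih _ _ (by omega) (by omega), h _ (by omega) _ (by omega)]
  have hl : m.toLinearMap = m'.toLinearMap :=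
    tensor_ext fun i hi j hj => ext_coeff fun k _ => hk k i j hi hj
  exact CoalgHom.ext fun c => LinearMap.congr_fun hl c

theorem structCoeff_eq_pCoeff {q : TruncDual K n ⊗[K] TruncDual K n →ₗc[K] TruncDual K n}
    {v₀ : ℕ} {f : K⟦X⟧} (h : ∀ i < n, ∀ j < n, structCoeff q i j 1 =
      PowerSeries.coeff i (PowerSeries.coeff j (G v₀ f))) (k : ℕ) {i j : ℕ} (hi : i < n)
    (hj : j < n) : structCoeff q i j k = pCoeff v₀ f i j k := by
  induction k generalizing i j with
  | zero => rw [structCoeff_zero q hi hj, pCoeff]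
  | succ k ih =>
    rcases k with _ | k
    · rw [h i hi j hj, pCoeff]
    · rw [add_comm (k + 1) 1, structCoeff_add q hi hj, add_comm 1 (k + 1), pCoeff]
      refine Finset.sum_congr rfl fun a ha => Finset.sum_congr rfl fun b hb => ?_
      have := Finset.HasAntidiagonal.mem_antidiagonal.1 ha
      have := Finset.HasAntidiagonal.mem_antidiagonal.1 hb
      rw [ih (by omega) (by omega), h _ (by omega) _ (by omega)]

/-- The coefficient of `x` in `G(x, y)` is `f(y)`. -/
theorem coeff_one_coeff_G [CharZero K] {f : K⟦X⟧} (hf : IsParameter n 1 f) (v : ℕ) :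
    PowerSeries.coeff 1 (PowerSeries.coeff v (G 1 f)) = PowerSeries.coeff v f := by
  have hfc : constantCoeff f = 1 := by
    rw [← coeff_zero_eq_constantCoeff_apply, hf.coeff_zero]
  have hdc : constantCoeff (derivative K f) = 1 := by
    rw [← coeff_zero_eq_constantCoeff_apply, coeff_derivative]; simp [hf.coeff_deg]
  have hg := g_mul_derivative hf
  rw [pow_one] at hg
  have hg0 : PowerSeries.coeff 0 (g 1 f) = 0 := by
    have := congrArg constantCoeff hg
    simpa [hfc, hdc] using this
  have hg1 : PowerSeries.coeff 1 (g 1 f) = 1 := by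
    obtain ⟨u, hu⟩ : X ∣ g 1 f := X_dvd_iff.2 (by rwa [← coeff_zero_eq_constantCoeff_apply])
    obtain ⟨w, hw⟩ : X ∣ f - 1 := X_dvd_iff.2 (by simp [hfc])
    have hw1 : constantCoeff w = 1 := by
      have : PowerSeries.coeff 1 (f - 1) = PowerSeries.coeff 1 (X * w) := by rw [hw]
      rw [map_sub, hf.coeff_deg, coeff_one, if_neg one_ne_zero, sub_zero,
        show PowerSeries.coeff 1 (X * w) = PowerSeries.coeff 0 w from coeff_succ_X_mul 0 w,
        coeff_zero_eq_constantCoeff_apply] at this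
      exact this.symm
    have h2 : u * derivative K f = f * w := by
      apply mul_left_cancel₀ (X_ne_zero (R := K))
      rw [← mul_assoc, ← hu, hg, hw]; ring
    have := congrArg constantCoeff h2
    rw [hu, ← zero_add 1, coeff_succ_X_mul, coeff_zero_eq_constantCoeff_apply]
    simpa [hfc, hdc, hw1] using this
  set r : K⟦X⟧ := PowerSeries.mk fun v => PowerSeries.coeff 1 (PowerSeries.coeff v (G 1 f)) with hr
  -- This is the part linear in x of f(y) G_y = f'(y) g(x) G_x: as g = x + ⋯, the series g(x) G_x
  -- and G have the same linear part.
  have hode : f * derivative K r = derivative K f * r := by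
    have h : PowerSeries.map C f * derivative K⟦X⟧ (G 1 f) =
        PowerSeries.map C (derivative K f) * fieldX (g 1 f) (G 1 f) := by
      have := (G_spec hf).2
      rw [fieldX_apply]
      simp only [map_sub, map_one] at this ⊢
      linear_combination this
    ext k
    have hk := congrArg (fun H => PowerSeries.coeff 1 (PowerSeries.coeff k H)) h
    have hX : ∀ l, PowerSeries.coeff 1 (PowerSeries.coeff l (fieldX (g 1 f) (G 1 f))) =
        PowerSeries.coeff 1 (PowerSeries.coeff l (G 1 f)) := by
      intro l
      rw [coeff_fieldX]
      simp [Finset.Nat.antidiagonal_succ, hg0, hg1]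
    simp only [PowerSeries.coeff_mul k, coeff_map, map_sum, coeff_C_mul, hX] at hk
    rw [PowerSeries.coeff_mul, PowerSeries.coeff_mul]
    refine Eq.trans (Finset.sum_congr rfl fun a _ => ?_)
      (hk.trans (Finset.sum_congr rfl fun a _ => ?_))
    · have : ((a.2 : K⟦X⟧) + 1) = C ((a.2 : K) + 1) := by simp
      rw [coeff_derivative, coeff_derivative, this, coeff_mul_C, hr, coeff_mk]
    · rw [hr, coeff_mk]
  -- The quotient r/f has zero derivative and constant term 1.
  have hrf : r * f⁻¹ = 1 := by
    refine derivative.ext ?_ ?_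
    · rw [Derivation.leibniz, derivative_inv', smul_eq_mul, smul_eq_mul, derivative_one]
      have hff : f * f⁻¹ = 1 := PowerSeries.mul_inv_cancel _ (by rw [hfc]; exact one_ne_zero)
      linear_combination (f⁻¹ ^ 2) * hode - f⁻¹ * derivative K r * hff
    · have : constantCoeff r = 1 := by
        rw [← coeff_zero_eq_constantCoeff_apply, hr, coeff_mk, (G_spec hf).1, coeff_one_X]
      simp [this, hfc]
  have hrf' : r = f := by
    have hff : f⁻¹ * f = 1 := PowerSeries.inv_mul_cancel _ (by rw [hfc]; exact one_ne_zero)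
    linear_combination f * hrf - r * hff
  rw [show PowerSeries.coeff v f = PowerSeries.coeff v r by rw [hrf'], hr, coeff_mk]

section Rescale

variable {lam : Kˣ} {m m' : TruncDual K n ⊗[K] TruncDual K n →ₗc[K] TruncDual K n}

theorem coeff_rescale (lam : Kˣ) (k : ℕ) (c : TruncDual K n) :
    coeff k (rescale K n lam c) = (lam : K) ^ k * coeff k c := by
  suffices h : coeffLin k ∘ₗ (rescaleLin K n lam) =
      (lam : K) ^ k • (coeffLin k : TruncDual K n →ₗ[K] K) by
    have := LinearMap.congr_fun h c
    rw [← coeffLin_apply, ← coeffLin_apply]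
    exact this
  refine linearMap_ext fun i hi => ?_
  rw [LinearMap.comp_apply, rescaleLin_x, map_smul, LinearMap.smul_apply, coeffLin_apply,
    coeff_x hi]
  split_ifs with h
  · rw [h]
  · simp

theorem structCoeff_of_rescale
    (h : ∀ a b, rescale K n lam (m (a ⊗ₜ b)) = m' (rescale K n lam a ⊗ₜ rescale K n lam b))
    (i j k : ℕ) :
    (lam : K) ^ k * structCoeff m i j k = (lam : K) ^ (i + j) * structCoeff m' i j k := by
  rw [structCoeff, ← coeff_rescale, h, rescale_x, rescale_x, TensorProduct.smul_tmul_smul,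
    map_smul, ← coeffLin_apply, map_smul, coeffLin_apply, ← pow_add, smul_eq_mul, structCoeff]

theorem eq_of_rescale {m'' : TruncDual K n ⊗[K] TruncDual K n →ₗc[K] TruncDual K n}
    {e : TruncDual K n ≃ₗc[K] TruncDual K n}
    (h : ∀ a b, e (m (a ⊗ₜ b)) = m' (e a ⊗ₜ e b)) (h' : ∀ a b, e (m (a ⊗ₜ b)) = m'' (e a ⊗ₜ e b)) :
    m' = m'' := by
  have hl : m'.toLinearMap = m''.toLinearMap := by
    refine TensorProduct.ext' fun a b => ?_
    obtain ⟨a, rfl⟩ := EquivLike.surjective e a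
    obtain ⟨b, rfl⟩ := EquivLike.surjective e b
    exact (h a b).symm.trans (h' a b)
  exact CoalgHom.ext fun c => LinearMap.congr_fun hl c

end Rescale

end TruncDual

/-! ### The classification in the nondegenerate case. -/

open TruncDual Standard in
theorem corollary4p6 {K : Type*} [Field K] [IsAlgClosed K] [CharZero K] (n : ℕ) (hn : 2 ≤ n)
    (p d : TruncDual K n ⊗[K] TruncDual K n →ₗc[K] TruncDual K n)
    (hpd : IsRegularQCycleCoalgebra p d) (h11 : TruncDual.structCoeff p 1 1 1 ≠ 0) :
    (∃ (f : PowerSeries K) (q : TruncDual K n ⊗[K] TruncDual K n →ₗc[K] TruncDual K n),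
      Standard.IsSCC n 1 f q ∧ IsCycleCoalgebra q ∧
      IsQMagmaIso (TruncDual.rescale K n (Units.mk0 _ h11)) p d q q ∧
      ∀ (lam : Kˣ) (f' : PowerSeries K)
        (q' : TruncDual K n ⊗[K] TruncDual K n →ₗc[K] TruncDual K n),
        Standard.IsSCC n 1 f' q' → IsQMagmaIso (TruncDual.rescale K n lam) p d q' q' →
          (lam : K) = TruncDual.structCoeff p 1 1 1 ∧ f' = f ∧ q' = q) ∧
    d = p ∧ HasInvolutiveSolution p d := by
  set e := rescale K n (Units.mk0 _ h11) with he
  have hreg := hpd.conjMul e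
  -- Rescaling by λ gives λ p_{11}^1 = λ² q_{11}^1, so λ = p_{11}^1 is the choice that normalizes
  -- q_{11}^1 to 1.
  have hq11 : structCoeff (conjMul e p) 1 1 1 = 1 := by
    have h := structCoeff_of_rescale (conjMul_apply e p) 1 1 1
    rw [Units.val_mk0, pow_one, one_add_one_eq_two, pow_two, mul_assoc] at h
    have h' := mul_left_cancel₀ h11 h
    exact (mul_left_cancel₀ h11 (h'.symm.trans (mul_one _).symm))
  obtain ⟨hf, hG⟩ := hreg.exists_eq_G hn hq11
  have hdq : conjMul e d = conjMul e p :=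
    coalgHom_ext fun i hi j hj => (hG i hi j hj).2.trans (hG i hi j hj).1.symm
  have hdp : d = p := by
    have hl : d.toLinearMap = p.toLinearMap := by
      refine TensorProduct.ext' fun a b => EquivLike.injective e ?_
      exact ((conjMul_apply e d a b).trans (by rw [hdq])).trans (conjMul_apply e p a b).symm
    exact CoalgHom.ext fun c => LinearMap.congr_fun hl c
  subst hdp
  refine ⟨⟨rowSeries (conjMul e d), conjMul e d,
    ⟨hf, fun i j k hi hj _ => structCoeff_eq_pCoeff (fun i hi j hj => (hG i hi j hj).1) k hi hj⟩,
    hreg, fun a b => ⟨conjMul_apply e d a b, conjMul_apply e d a b⟩, ?_⟩, rfl,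
    fun r hr => braiding_comp_braiding hn hr⟩
  intro lam f' q' hq' hiso
  -- The row of index 1 of a standard cycle coalgebra is its parameter. Its linear coefficient 1
  -- pins down λ, and then q' and f' are determined.
  have hrow : ∀ v < n, structCoeff q' 1 v 1 = PowerSeries.coeff v f' := by
    intro v hv
    rw [hq'.2 1 v 1 (by omega) hv (by omega), pCoeff, coeff_one_coeff_G hq'.1]
  have hlam : (lam : K) = structCoeff d 1 1 1 := by
    have h := structCoeff_of_rescale (fun a b => (hiso a b).1) 1 1 1
    rw [hrow 1 (by omega), hq'.1.coeff_deg, pow_one, mul_one, one_add_one_eq_two, pow_two] at h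
    exact (mul_left_cancel₀ lam.ne_zero h).symm
  have hlam' : lam = Units.mk0 _ h11 := Units.ext hlam
  subst hlam'
  have hqq : q' = conjMul e d := eq_of_rescale (fun a b => (hiso a b).1) (conjMul_apply e d)
  refine ⟨hlam, ?_, hqq⟩
  ext v
  rcases lt_or_ge v n with hv | hv
  · rw [coeff_rowSeries, ← hrow v hv, hqq]
  · rw [hq'.1.coeff_ge v hv, hf.coeff_ge v hv]
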